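/- Let $\tau>0$ be a fixed known constant. Let $(W_t)$ be a standard Brownian motion and, for each $n$, let $\epsilon_{1,n},\dots,\epsilon_{n,n}$ be i.i.d. $\mathcal N(0,1)$ random variables independent of $W$. For a positive continuous deterministic function $\sigma$ on $[0,1]$ let $X_t=\int_0^t\sigma(s)\,dW_s$ (with continuous paths), and suppose that one observes $$\bar Y_{i,n}=\int_0^{i/n}X_s\,ds+\tau\,\epsilon_{i,n},\qquad i=1,\dots,n .$$ For $\alpha>0$, $L>0$, $0<l<u<\infty$ and $p=[\alpha]$ (the integer part of $\alpha$), let $\mathcal C^b(\alpha,L)=\mathcal C^b(\alpha,L,[l,u])$ be the set of functions $f$ on $[0,1]$ such that $f^{(p)}$ exists on $[0,1]$, $|f^{(p)}(x)-f^{(p)}(y)|\le L|x-y|^{\alpha-p}$ for all $x,y\in[0,1]$, and $l\le f\le u$. Write $\|\cdot\|_2$ for the norm of $L_2[0,1]$. **Theorem.** (i) Let $\alpha>1/2$, $L>0$ and $0<l<u<\infty$. There is a constant $C>0$, depending only on $\alpha,L,l,u$ (and on the fixed noise level $\tau$), such that $$\liminf_{n\to\infty}\ \inf_{\hat\sigma^2_n}\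 \sup_{\sigma^2\in\mathcal C^b(\alpha,L)}\ \mathrm E\Big(n^{\frac{\alpha}{4\alpha+2}}\,\|\hat\sigma^2_n-\sigma^2\|_2^2\Big)\ \ge\ C,$$ where the infimum is over all estimators, i.e. all (measurable) functions of $(\bar Y_{1,n},\dots,\bar Y_{n,n})$ with values in the functions on $[0,1]$. So the minimax rate in $L_2$-norm is no better than $n^{-\alpha/(8\alpha+4)}$. (ii) Let $0<\sigma_{\min}<\sigma_{\max}<\infty$. There is a constant $\tilde C>0$, depending only on $\sigma_{\min},\sigma_{\max}$ (and on the fixed noise level $\tau$), such that, when $\sigma$ is constant, $$\liminf_{n\to\infty}\ \inf_{\hat\sigma^2_n}\ \sup_{\sigma^2\in[\sigma_{\min},\sigma_{\max}]}\ \mathrm E\Big(n^{1/4}\,(\hat\sigma^2_n-\sigma^2)^2\Big)\ \ge\ \tilde C,$$ where the infimum is over all real-valued (measurable) functions of $(\bar Y_{1,n},\dots,\bar Y_{n,n})$. So the rate is no better than $n^{-1/8}$. -/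

import Mathlib

open MeasureTheory ProbabilityTheory Filter Set
open scoped ENNReal NNReal Topology

/-- The class of uniformly bounded Hölder functions of index `α` on `[0,1]`: with `p = [α]` the
integer part of `α`, the `p`-th derivative of `f` exists on `[0,1]` (one-sided at the end points),
it satisfies `|f^(p) x - f^(p) y| ≤ L |x - y|^(α - p)`, and `l ≤ f ≤ u` on `[0,1]`. The values of
`f` outside `[0,1]` play no role. -/
def holderClass (α L l u : ℝ) : Set (ℝ → ℝ) :=
  {f | (∀ k < ⌊α⌋₊,
          DifferentiableOn ℝ (iteratedDerivWithin k f (Icc 0 1)) (Icc 0 1)) ∧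
       (∀ x ∈ Icc (0 : ℝ) 1, ∀ y ∈ Icc (0 : ℝ) 1,
          |iteratedDerivWithin ⌊α⌋₊ f (Icc 0 1) x - iteratedDerivWithin ⌊α⌋₊ f (Icc 0 1) y|
            ≤ L * |x - y| ^ (α - (⌊α⌋₊ : ℝ))) ∧
       (∀ x ∈ Icc (0 : ℝ) 1, l ≤ f x ∧ f x ≤ u)}

/-- The step function `∑_{k < m} c k · 1_{(s k, s (k+1)]}` on the real line. -/
noncomputable def stepFunction (m : ℕ) (s : ℕ → ℝ≥0) (c : ℕ → ℝ) (r : ℝ) : ℝ :=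
  ∑ k ∈ Finset.range m, (Ioc (s k : ℝ) (s (k + 1) : ℝ)).indicator (fun _ => c k) r

/-- The integral `∑_{k < m} c k · (W_{s (k+1)} - W_{s k})` of a step function against `W`. -/
def stepIntegral {Ω : Type*} (W : ℝ≥0 → Ω → ℝ) (m : ℕ) (s : ℕ → ℝ≥0) (c : ℕ → ℝ) (ω : Ω) : ℝ :=
  ∑ k ∈ Finset.range m, c k * (W (s (k + 1)) ω - W (s k) ω)

/-- `Z` is (a version of) the Wiener integral `∫_0^t f dW` of the deterministic function
`f ∈ L²(0,t)`: there are step functions `g` on `(0,t]` which are simultaneously arbitrarily close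
to `f` in `L²(0,t)` and have `∫ g dW` arbitrarily close to `Z` in `L²(P)`. -/
def IsWienerIntegral {Ω : Type*} [MeasurableSpace Ω] (P : Measure Ω) (W : ℝ≥0 → Ω → ℝ)
    (f : ℝ → ℝ) (t : ℝ≥0) (Z : Ω → ℝ) : Prop :=
  MemLp f 2 (volume.restrict (Ioc (0 : ℝ) t)) ∧ MemLp Z 2 P ∧
  ∀ δ : ℝ≥0∞, 0 < δ → ∃ (m : ℕ) (s : ℕ → ℝ≥0) (c : ℕ → ℝ), Monotone s ∧ (∀ k, s k ≤ t) ∧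
    eLpNorm (fun r => f r - stepFunction m s c r) 2 (volume.restrict (Ioc (0 : ℝ) t)) ≤ δ ∧
    eLpNorm (fun ω => Z ω - stepIntegral W m s c ω) 2 P ≤ δ

/-- `X` is (a version with almost surely continuous paths of) the process
`X_t = ∫_0^t σ(s) dW_s`, `t ∈ [0,1]`. -/
structure IsWienerIntegralProcess {Ω : Type*} [MeasurableSpace Ω] (P : Measure Ω)
    (W : ℝ≥0 → Ω → ℝ) (σ : ℝ → ℝ) (X : ℝ≥0 → Ω → ℝ) : Prop where
  isWienerIntegral : ∀ t ≤ 1, IsWienerIntegral P W σ t (X t)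
  continuousOn : ∀ᵐ ω ∂P, ContinuousOn (fun t => X t ω) (Icc 0 1)

/-- The random elements of the model: a standard Brownian motion `W`, for each `n` a vector
`ε n = (ε_{1,n}, …, ε_{n,n})` of i.i.d. standard normal variables independent of `W` and, for each
positive continuous deterministic volatility `σ` on `[0,1]`, the process
`X σ = (∫_0^t σ(s) dW_s)_{t ∈ [0,1]}`. -/
structure IsNoisyVolatilityModel {Ω : Type*} [MeasurableSpace Ω] (P : Measure Ω)
    (W : ℝ≥0 → Ω → ℝ) (ε : (n : ℕ) → Fin n → Ω → ℝ) (X : (ℝ → ℝ) → ℝ≥0 → Ω → ℝ) : Prop where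
  brownian : IsBrownianReal W P
  noise_law : ∀ n i, HasLaw (ε n i) (gaussianReal 0 1) P
  noise_indep : ∀ n, iIndepFun (ε n) P
  indep : ∀ n, IndepFun (fun ω t => W t ω) (fun ω i => ε n i ω) P
  process : ∀ σ : ℝ → ℝ, ContinuousOn σ (Icc 0 1) → (∀ s ∈ Icc (0 : ℝ) 1, 0 < σ s) →
    IsWienerIntegralProcess P W σ (X σ)

/-- The observation vector `(∫_0^{i/n} X_s ds + τ ε_{i,n})_{i = 1, …, n}`. The index `i : Fin n`
stands for the one-based index `i + 1`. -/
noncomputable def integratedObservation {Ω : Type*} (τ : ℝ) (n : ℕ) (X : ℝ≥0 → Ω → ℝ)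
    (ε : Fin n → Ω → ℝ) (ω : Ω) : Fin n → ℝ :=
  fun i => (∫ s in (0 : ℝ)..((i : ℝ) + 1) / n, X s.toNNReal ω) + τ * ε i ω

/-- The squared `L²[0,1]`-distance `‖f - g‖₂²`, with values in `[0, ∞]`. -/
noncomputable def sqL2Dist (f g : ℝ → ℝ) : ℝ≥0∞ :=
  ∫⁻ t in Icc (0 : ℝ) 1, ENNReal.ofReal ((f t - g t) ^ 2)

/-- The minimax risk `inf_{σ̂²} sup_{σ² ∈ V} E (r · ‖σ̂² - σ²‖₂²)` for estimation of the function
`σ²` from `n` observations. The infimum is over all estimators, i.e. all (jointly measurable) maps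
from the observation vector to functions on `[0,1]`. -/
noncomputable def minimaxRiskFun {Ω : Type*} [MeasurableSpace Ω] (P : Measure Ω) (τ : ℝ) (n : ℕ)
    (ε : Fin n → Ω → ℝ) (X : (ℝ → ℝ) → ℝ≥0 → Ω → ℝ) (V : Set (ℝ → ℝ)) (r : ℝ) : ℝ≥0∞ :=
  ⨅ (est : (Fin n → ℝ) → ℝ → ℝ) (_ : Measurable (Function.uncurry est)),
    ⨆ v ∈ V, ∫⁻ ω, ENNReal.ofReal r *
      sqL2Dist (est (integratedObservation τ n (X fun s => √(v s)) ε ω)) v ∂P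

/-- The minimax risk `inf_{σ̂²} sup_{σ² ∈ V} E (r · (σ̂² - σ²)²)` for estimation of the number `σ²`
when the volatility `σ` is constant in time. -/
noncomputable def minimaxRiskConst {Ω : Type*} [MeasurableSpace Ω] (P : Measure Ω) (τ : ℝ) (n : ℕ)
    (ε : Fin n → Ω → ℝ) (X : (ℝ → ℝ) → ℝ≥0 → Ω → ℝ) (V : Set ℝ) (r : ℝ) : ℝ≥0∞ :=
  ⨅ (est : (Fin n → ℝ) → ℝ) (_ : Measurable est),
    ⨆ v ∈ V, ∫⁻ ω, ENNReal.ofReal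
      (r * (est (integratedObservation τ n (X fun _ => √v) ε ω) - v) ^ 2) ∂P

/-! Write v for σ². Since ∫_0^t X_s ds = ∫ (t-s)₊ dX_s, the observation vector is centred Gaussian
with covariance Γ(v) = K(v) + τ² I, where K(v) has entries ∫ v · ramp_i · ramp_j and is linear in v.
The lower bounds come from the slow growth of the information about v: it behaves like n^(1/4)
rather than n.

Replace v by v + h with 0 ≤ h ≤ κ v. Diagonalising Γ(v) and K(h) simultaneously turns the two laws
into products of N(0, 1) and of N(0, 1 + d_r), where the d_r are the eigenvalues of Γ(v)⁻¹ K(h).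
Their Hellinger affinity is at least exp(-∑ d_r² / 16), and d_r ≤ κ gives ∑ d_r² ≤ κ tr(Γ(v)⁻¹
K(h)). This is `two_point_observation`.

The trace is controlled in `trace_inv_obsMat_mul_covMat_le`. The ramps are within M^(-3/2) in L² of
a space of dimension at most 2(M+1). Each direction of that space costs at most 1/l, because Γ(v)
dominates K(v), and the n remainders together cost at most n / (τ² M³), because Γ(v) dominates τ² I.
Taking M near n^(1/4) balances the two, so that tr(Γ(v)⁻¹ K(h)) is at most a constant times n^(1/4)
sup h.

For constant σ², two values at distance of order n^(-1/8) therefore cannot be separated. For a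
Hölder class, `assouad` is applied to m bumps of height A = a m^(-α) on disjoint cells. The trace is
linear in h and the sum of the bumps is still at most A, so the total cost over all bumps is of
order A² n^(1/4). It has to stay below m/4, which holds when m^(2α+1) is of order n^(1/4). The
resulting risk is of order A², that is n^(-α/(4α+2)). -/

/-! ### Le Cam's bound for Gaussian product measures -/

/-- Le Cam's two-point bound in terms of the Hellinger affinity. -/
theorem two_point_of_affinity {α : Type*} [MeasurableSpace α] (μ ν : Measure α)
    [IsProbabilityMeasure μ] [IsProbabilityMeasure ν] (r : α → ℝ) (hr : Measurable r)
    (hν : ν = μ.withDensity fun x => ENNReal.ofReal (r x ^ 2))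
    (ρ : ℝ) (hρ0 : 0 ≤ ρ) (hρ : ENNReal.ofReal ρ ≤ ∫⁻ x, ENNReal.ofReal (r x) ∂μ)
    (f : α → ℝ) (hf : Measurable f) (a b : ℝ) :
    ENNReal.ofReal ((a - b) ^ 2 * ρ ^ 2 / 2) ≤
      ∫⁻ x, ENNReal.ofReal ((f x - a) ^ 2) ∂μ + ∫⁻ x, ENNReal.ofReal ((f x - b) ^ 2) ∂ν := by
  set d2 := (a - b) ^ 2 with hd2
  have hd2' : 0 ≤ d2 := sq_nonneg _
  have hr2 : Measurable fun x => ENNReal.ofReal (r x ^ 2) := by fun_prop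
  have hmass : ∫⁻ x, ENNReal.ofReal (r x ^ 2) ∂μ = 1 := by
    have := measure_univ (μ := ν)
    rwa [hν, withDensity_apply _ MeasurableSet.univ, Measure.restrict_univ] at this
  have hR1 : ∫⁻ x, ENNReal.ofReal ((f x - b) ^ 2) ∂ν =
      ∫⁻ x, ENNReal.ofReal (r x ^ 2 * (f x - b) ^ 2) ∂μ := by
    rw [hν, lintegral_withDensity_eq_lintegral_mul _ hr2 (by fun_prop)]
    refine lintegral_congr fun x => ?_
    rw [Pi.mul_apply, ENNReal.ofReal_mul (sq_nonneg _)]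
  -- Minimising over the value `f x` leaves (a-b)² r²/(1+r²). This is bounded below by a function
  -- linear in r and 1 + r² by completing a square, so only the affinity and the two total masses
  -- enter after integration.
  have key : ∀ x, ENNReal.ofReal (d2 * ρ) * ENNReal.ofReal (r x) ≤
      ENNReal.ofReal ((f x - a) ^ 2) + ENNReal.ofReal (r x ^ 2 * (f x - b) ^ 2) +
        ENNReal.ofReal (d2 * ρ ^ 2 / 4) * (1 + ENNReal.ofReal (r x ^ 2)) := by
    intro x
    have h1 : (1 : ℝ≥0∞) = ENNReal.ofReal 1 := by simp
    rw [h1, ← ENNReal.ofReal_mul (by positivity), ← ENNReal.ofReal_add (by positivity)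
      (by positivity), ← ENNReal.ofReal_add (by positivity) (by positivity),
      ← ENNReal.ofReal_mul (by positivity), ← ENNReal.ofReal_add (by positivity) (by positivity)]
    apply ENNReal.ofReal_le_ofReal
    have h2 : 0 < 1 + r x ^ 2 := by positivity
    have h3 : d2 * (r x ^ 2 / (1 + r x ^ 2)) ≤ (f x - a) ^ 2 + r x ^ 2 * (f x - b) ^ 2 := by
      rw [← mul_div_assoc, div_le_iff₀ h2]
      nlinarith [sq_nonneg ((f x - a) + r x ^ 2 * (f x - b))]
    have h4 : ρ * r x ≤ r x ^ 2 / (1 + r x ^ 2) + ρ ^ 2 / 4 * (1 + r x ^ 2) := by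
      rw [← sub_nonneg]
      have : r x ^ 2 / (1 + r x ^ 2) + ρ ^ 2 / 4 * (1 + r x ^ 2) - ρ * r x =
          (r x - ρ / 2 * (1 + r x ^ 2)) ^ 2 / (1 + r x ^ 2) := by field_simp; ring
      rw [this]; positivity
    nlinarith [mul_le_mul_of_nonneg_left h4 hd2']
  have hint := lintegral_mono (μ := μ) key
  rw [lintegral_const_mul _ (by fun_prop), lintegral_add_left (by fun_prop),
    lintegral_add_left (by fun_prop), lintegral_const_mul _ (by fun_prop),
    lintegral_add_left (by fun_prop), hmass, ← hR1] at hint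
  simp only [lintegral_const, measure_univ, mul_one] at hint
  have h5 : ENNReal.ofReal (d2 * ρ ^ 2 / 2) + ENNReal.ofReal (d2 * ρ ^ 2 / 4) * (1 + 1) ≤
      ENNReal.ofReal (d2 * ρ) * ∫⁻ x, ENNReal.ofReal (r x) ∂μ := by
    calc _ = ENNReal.ofReal (d2 * ρ) * ENNReal.ofReal ρ := by
          have h1 : (1 + 1 : ℝ≥0∞) = ENNReal.ofReal 2 := by norm_num
          rw [h1, ← ENNReal.ofReal_mul (by positivity), ← ENNReal.ofReal_mul (by positivity),
            ← ENNReal.ofReal_add (by positivity) (by positivity)]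
          congr 1; ring
      _ ≤ _ := by gcongr
  refine (ENNReal.add_le_add_iff_right ?_).1 (h5.trans hint)
  exact ENNReal.mul_ne_top ENNReal.ofReal_ne_top (by norm_num)

theorem lintegral_pi_prod {ι : Type*} [Fintype ι] {α : ι → Type*} [∀ i, MeasurableSpace (α i)]
    (μ : ∀ i, Measure (α i)) [∀ i, IsProbabilityMeasure (μ i)] (f : ∀ i, α i → ℝ≥0∞)
    (hf : ∀ i, Measurable (f i)) :
    ∫⁻ x, ∏ i, f i (x i) ∂(Measure.pi μ) = ∏ i, ∫⁻ y, f i y ∂(μ i) := by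
  have h := lintegral_prod_eq_prod_lintegral_of_indepFun (μ := Measure.pi μ) Finset.univ
    (fun i x => f i (x i)) (iIndepFun_pi fun i => (hf i).aemeasurable)
    (fun i => (hf i).comp (measurable_pi_apply i))
  rw [h]
  refine Finset.prod_congr rfl fun i _ => ?_
  rw [← (measurePreserving_eval μ i).lintegral_comp (hf i)]

theorem pi_withDensity_prod {ι : Type*} [Fintype ι] {α : ι → Type*} [∀ i, MeasurableSpace (α i)]
    (μ : ∀ i, Measure (α i)) [∀ i, IsProbabilityMeasure (μ i)] (f : ∀ i, α i → ℝ≥0∞)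
    (hf : ∀ i, Measurable (f i)) [∀ i, SigmaFinite ((μ i).withDensity (f i))] :
    Measure.pi (fun i => (μ i).withDensity (f i)) =
      (Measure.pi μ).withDensity fun x => ∏ i, f i (x i) := by
  refine Measure.pi_eq fun s hs => ?_
  rw [withDensity_apply _ (MeasurableSet.univ_pi hs), ← lintegral_indicator
    (MeasurableSet.univ_pi hs)]
  have : ∀ x : ∀ i, α i, (univ.pi s).indicator (fun x => ∏ i, f i (x i)) x =
      ∏ i, (s i).indicator (f i) (x i) := by
    intro x
    by_cases hx : x ∈ univ.pi s
    · rw [indicator_of_mem hx]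
      exact Finset.prod_congr rfl fun i _ => (indicator_of_mem (hx i (mem_univ i)) _).symm
    · rw [indicator_of_notMem hx]
      simp only [mem_univ_pi, not_forall] at hx
      obtain ⟨i, hi⟩ := hx
      exact (Finset.prod_eq_zero (Finset.mem_univ i) (indicator_of_notMem hi _)).symm
  simp_rw [this]
  rw [lintegral_pi_prod _ _ fun i => (hf i).indicator (hs i)]
  exact Finset.prod_congr rfl fun i _ => by
    rw [lintegral_indicator (hs i), withDensity_apply _ (hs i)]

/-- The square root of the density of `N(0, d)` with respect to `N(0, 1)`. -/
noncomputable def gaussianSqrtDensity (d x : ℝ) : ℝ :=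
  √(√d)⁻¹ * Real.exp (x ^ 2 / 4 - x ^ 2 / (4 * d))

theorem gaussianReal_eq_withDensity {d : ℝ≥0} (hd : d ≠ 0) :
    gaussianReal 0 d = (gaussianReal 0 1).withDensity
      fun x => ENNReal.ofReal (gaussianSqrtDensity d x ^ 2) := by
  rw [gaussianReal_of_var_ne_zero _ hd, gaussianReal_of_var_ne_zero _ one_ne_zero,
    ← withDensity_mul _ (measurable_gaussianPDF 0 1)
      (by unfold gaussianSqrtDensity; fun_prop)]
  congr 1
  ext x
  have hd0 : (0 : ℝ) < d := by positivity
  rw [Pi.mul_apply, gaussianPDF, gaussianPDF, ← ENNReal.ofReal_mul (gaussianPDFReal_nonneg _ _ _)]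
  congr 1
  rw [gaussianPDFReal, gaussianPDFReal, gaussianSqrtDensity, mul_pow, Real.sq_sqrt (by positivity),
    ← Real.exp_nat_mul]
  have : √(2 * Real.pi * d) = √(2 * Real.pi * 1) * √d := by
    rw [mul_one, Real.sqrt_mul (by positivity)]
  simp only [NNReal.coe_one]
  rw [this, mul_inv]
  have h2 : Real.exp (-(x - 0) ^ 2 / (2 * d)) = Real.exp (-(x - 0) ^ 2 / (2 * 1)) *
      Real.exp ((2 : ℕ) * (x ^ 2 / 4 - x ^ 2 / (4 * d))) := by
    rw [← Real.exp_add]; congr 1; push_cast; field_simp; ring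
  rw [h2]; ring

/-- The affinity is explicit: its inverse fourth power is (1 + t/2)² / (1 + t), which is at most 1 +
t²/4 and hence at most exp(t²/4). -/
theorem exp_le_integral_gaussianSqrtDensity (t : ℝ) (ht : 0 ≤ t) :
    ENNReal.ofReal (Real.exp (-(t ^ 2 / 16))) ≤
      ∫⁻ x, ENNReal.ofReal (gaussianSqrtDensity (1 + t) x) ∂(gaussianReal 0 1) := by
  set d := 1 + t with hd
  have hd0 : 0 < d := by positivity
  have hmeas : Measurable fun x => ENNReal.ofReal (gaussianSqrtDensity d x) := by
    unfold gaussianSqrtDensity; fun_prop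
  have hb : 0 < (1 + d) / (4 * d) := by positivity
  have hprod : ∀ x, gaussianPDFReal 0 1 x * gaussianSqrtDensity d x =
      (√(2 * Real.pi))⁻¹ * √(√d)⁻¹ * Real.exp (-((1 + d) / (4 * d)) * x ^ 2) := by
    intro x
    rw [gaussianPDFReal, gaussianSqrtDensity]
    have : Real.exp (-((1 + d) / (4 * d)) * x ^ 2) =
      Real.exp (-(x - 0) ^ 2 / (2 * (1 : ℝ≥0))) * Real.exp (x ^ 2 / 4 - x ^ 2 / (4 * d)) := by
      rw [← Real.exp_add]; congr 1; push_cast; field_simp; ring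
    rw [this]; simp only [NNReal.coe_one, mul_one]; ring
  rw [gaussianReal_of_var_ne_zero _ one_ne_zero,
    lintegral_withDensity_eq_lintegral_mul _ (measurable_gaussianPDF 0 1) hmeas]
  have : ∀ x, (gaussianPDF 0 1 * fun x => ENNReal.ofReal (gaussianSqrtDensity d x)) x =
      ENNReal.ofReal ((√(2 * Real.pi))⁻¹ * √(√d)⁻¹ *
        Real.exp (-((1 + d) / (4 * d)) * x ^ 2)) := by
    intro x
    rw [Pi.mul_apply, gaussianPDF, ← ENNReal.ofReal_mul (gaussianPDFReal_nonneg _ _ _), hprod]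
  simp_rw [this]
  rw [← ofReal_integral_eq_lintegral_ofReal ((integrable_exp_neg_mul_sq hb).const_mul _)
    (ae_of_all _ fun x => by positivity), integral_const_mul, integral_gaussian]
  apply ENNReal.ofReal_le_ofReal
  have e1 : (√(2 * Real.pi))⁻¹ * √(√d)⁻¹ * √(Real.pi / ((1 + d) / (4 * d))) =
      √(2 * √d / (1 + d)) := by
    rw [← Real.sqrt_inv, ← Real.sqrt_mul (by positivity), ← Real.sqrt_mul (by positivity)]
    congr 1
    have : √d * √d = d := Real.mul_self_sqrt hd0.le
    have h0 : 0 < √d := Real.sqrt_pos.2 hd0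
    field_simp
    nlinarith
  rw [e1]
  apply Real.le_sqrt_of_sq_le
  rw [← Real.exp_nat_mul]
  have e2 : 2 * √d / (1 + d) = √(d / (1 + t / 2) ^ 2) := by
    rw [Real.sqrt_div hd0.le, Real.sqrt_sq (by positivity)]
    have : 1 + d = 2 * (1 + t / 2) := by rw [hd]; ring
    rw [this]; field_simp
  rw [e2]
  apply Real.le_sqrt_of_sq_le
  rw [← Real.exp_nat_mul]
  have e3 : ((2 : ℕ) : ℝ) * (((2 : ℕ) : ℝ) * -(t ^ 2 / 16)) = -(t ^ 2 / 4) := by push_cast; ring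
  rw [e3, Real.exp_neg, ← inv_inv (d / (1 + t / 2) ^ 2)]
  apply inv_anti₀ (by positivity)
  rw [inv_div]
  calc (1 + t / 2) ^ 2 / d ≤ t ^ 2 / 4 + 1 := by
        rw [div_le_iff₀ hd0, hd]; nlinarith [pow_nonneg ht 3]
    _ ≤ _ := Real.add_one_le_exp _

/-- The two-point bound for two centred Gaussian product measures with variances `1` and
`1 + t i`. -/
theorem two_point_pi_gaussian {ι : Type*} [Fintype ι] (t : ι → ℝ≥0) (f : (ι → ℝ) → ℝ)
    (hf : Measurable f) (a b : ℝ) :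
    ENNReal.ofReal ((a - b) ^ 2 * Real.exp (-(∑ i, (t i : ℝ) ^ 2) / 8) / 2) ≤
      ∫⁻ x, ENNReal.ofReal ((f x - a) ^ 2) ∂(Measure.pi fun _ => gaussianReal 0 1) +
      ∫⁻ x, ENNReal.ofReal ((f x - b) ^ 2) ∂(Measure.pi fun i => gaussianReal 0 (1 + t i)) := by
  have hmeas : ∀ d, Measurable (gaussianSqrtDensity d) := by
    intro d; unfold gaussianSqrtDensity; fun_prop
  have hnn : ∀ d x, 0 ≤ gaussianSqrtDensity d x := by
    intro d x; unfold gaussianSqrtDensity; positivity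
  have h := two_point_of_affinity (Measure.pi fun _ : ι => gaussianReal 0 1)
    (Measure.pi fun i => gaussianReal 0 (1 + t i))
    (fun x => ∏ i, gaussianSqrtDensity (1 + t i) (x i))
    (Finset.measurable_prod _ fun i _ => (hmeas _).comp (measurable_pi_apply i))
    ?_
    (Real.exp (-(∑ i, (t i : ℝ) ^ 2) / 16)) (Real.exp_nonneg _) ?_ f hf a b
  · have e : Real.exp (-(∑ i, (t i : ℝ) ^ 2) / 16) ^ 2 =
        Real.exp (-(∑ i, (t i : ℝ) ^ 2) / 8) := by
      rw [← Real.exp_nat_mul]; congr 1; push_cast; ring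
    rwa [e] at h
  · have e : ∀ i, gaussianReal 0 (1 + t i) = (gaussianReal 0 1).withDensity
        fun x => ENNReal.ofReal (gaussianSqrtDensity (1 + t i) x ^ 2) := fun i => by
      have := gaussianReal_eq_withDensity (d := 1 + t i) (by positivity)
      simpa using this
    have : ∀ i, SigmaFinite ((gaussianReal 0 1).withDensity
        fun x => ENNReal.ofReal (gaussianSqrtDensity (1 + t i) x ^ 2)) := fun i => by
      rw [← e]; infer_instance
    simp_rw [e]
    rw [pi_withDensity_prod _ _ fun i => ((hmeas _).pow_const 2).ennreal_ofReal]
    congr 1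
    ext x
    rw [← ENNReal.ofReal_prod_of_nonneg fun i _ => sq_nonneg _, Finset.prod_pow]
  · simp_rw [ENNReal.ofReal_prod_of_nonneg fun i _ => hnn _ _]
    rw [lintegral_pi_prod _ _ fun i => (hmeas _).ennreal_ofReal, neg_div, Finset.sum_div,
      ← Finset.sum_neg_distrib, Real.exp_sum,
      ENNReal.ofReal_prod_of_nonneg fun i _ => Real.exp_nonneg _]
    exact Finset.prod_le_prod' fun i _ => exp_le_integral_gaussianSqrtDensity _ (t i).2

/-! ### Characteristic functions on finite products -/

theorem integral_cexp_pi_gaussian {ι : Type*} [Fintype ι] (d : ι → ℝ≥0) (u : ι → ℝ) :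
    ∫ x, Complex.exp ((∑ i, u i * x i : ℝ) * Complex.I)
      ∂(Measure.pi fun i => gaussianReal 0 (d i)) =
      Complex.exp (-((∑ i, d i * u i ^ 2 : ℝ) : ℂ) / 2) := by
  have h1 : ∀ x : ι → ℝ, Complex.exp ((∑ i, u i * x i : ℝ) * Complex.I) =
      ∏ i, Complex.exp (u i * x i * Complex.I) := by
    intro x
    rw [← Complex.exp_sum]; push_cast; rw [Finset.sum_mul]
  simp_rw [h1]
  rw [integral_fintype_prod_eq_prod (f := fun i (y : ℝ) => Complex.exp (u i * y * Complex.I))]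
  have h2 : ∀ i, ∫ y : ℝ, Complex.exp (u i * y * Complex.I) ∂gaussianReal 0 (d i) =
      Complex.exp (-(d i * u i ^ 2 : ℂ) / 2) := by
    intro i
    rw [← charFun_apply_real, charFun_gaussianReal]
    congr 1
    push_cast; ring
  simp_rw [h2]
  rw [← Complex.exp_sum, ← Finset.sum_div, Finset.sum_neg_distrib]
  push_cast; rfl

/-- Every continuous linear functional on a finite product is a coordinate sum, so these integrals
are the whole characteristic function. -/
theorem measure_ext_of_integral_cexp {ι : Type*} [Fintype ι] (μ ν : Measure (ι → ℝ))
    [IsFiniteMeasure μ] [IsFiniteMeasure ν]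
    (h : ∀ u : ι → ℝ, ∫ x, Complex.exp ((∑ i, u i * x i : ℝ) * Complex.I) ∂μ =
      ∫ x, Complex.exp ((∑ i, u i * x i : ℝ) * Complex.I) ∂ν) : μ = ν := by
  classical
  refine Measure.ext_of_charFunDual (funext fun L => ?_)
  have hL : ∀ x : ι → ℝ, L x = ∑ i, L (fun j => if i = j then 1 else 0) * x i := by
    intro x
    refine ((L : (ι → ℝ) →ₗ[ℝ] ℝ).pi_apply_eq_sum_univ x).trans ?_
    exact Finset.sum_congr rfl fun i _ => by rw [smul_eq_mul, mul_comm]; rfl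
  have hc : ∀ ρ : Measure (ι → ℝ), charFunDual ρ L = ∫ x, Complex.exp
      ((∑ i, L (fun j => if i = j then 1 else 0) * x i : ℝ) * Complex.I) ∂ρ := fun ρ => by
    rw [charFunDual_apply]
    exact integral_congr_ae (ae_of_all _ fun x => by dsimp only; rw [hL x])
  rw [hc, hc]
  exact h _

/-! ### Linear algebra: whitening and trace bounds -/

open Matrix in
/-- Simultaneous diagonalisation of a positive definite and a positive semidefinite matrix. -/
theorem exists_simultaneous_diagonalization {ι : Type*} [Fintype ι] [DecidableEq ι]
    (A K : Matrix ι ι ℝ) (hA : A.PosDef) (hK : K.PosSemidef) :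
    ∃ (T : Matrix ι ι ℝ) (d : ι → ℝ), T * A * Tᵀ = 1 ∧ T * K * Tᵀ = diagonal d ∧
      Tᵀ * T = A⁻¹ ∧ ∀ i, 0 ≤ d i := by
  -- Whitening: `B` is D^(-1/2) U* from the spectral decomposition of `A`. A rotation diagonalising
  -- B K Bᵀ will not disturb B A Bᵀ = 1.
  obtain ⟨B, hB⟩ : ∃ B : Matrix ι ι ℝ, B * A * Bᵀ = 1 := by
    have hs := hA.1.spectral_theorem
    set U : Matrix ι ι ℝ := (hA.1.eigenvectorUnitary : Matrix ι ι ℝ) with hU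
    have hU1 : star U * U = 1 := Unitary.coe_star_mul_self _
    have hpos := hA.eigenvalues_pos
    refine ⟨diagonal (fun i => (√(hA.1.eigenvalues i))⁻¹) * star U, ?_⟩
    have hA' : A = U * diagonal hA.1.eigenvalues * star U := by
      conv_lhs => rw [hs]
      rfl
    have ht : (diagonal (fun i => (√(hA.1.eigenvalues i))⁻¹) * star U)ᵀ =
        U * diagonal (fun i => (√(hA.1.eigenvalues i))⁻¹) := by
      rw [transpose_mul, diagonal_transpose, star_eq_conjTranspose, conjTranspose_eq_transpose_of_trivial,
        transpose_transpose]
    rw [ht]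
    calc _ = diagonal (fun i => (√(hA.1.eigenvalues i))⁻¹) * (star U * A * U) *
          diagonal (fun i => (√(hA.1.eigenvalues i))⁻¹) := by simp only [Matrix.mul_assoc]
      _ = diagonal (fun i => (√(hA.1.eigenvalues i))⁻¹) * diagonal hA.1.eigenvalues *
          diagonal (fun i => (√(hA.1.eigenvalues i))⁻¹) := by
          congr 2
          conv_lhs => rw [hA']
          calc _ = (star U * U) * diagonal hA.1.eigenvalues * (star U * U) := by
                simp only [Matrix.mul_assoc]
            _ = _ := by rw [hU1, Matrix.one_mul, Matrix.mul_one]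
      _ = 1 := by
          rw [diagonal_mul_diagonal, diagonal_mul_diagonal, ← diagonal_one]
          congr 1; ext i
          have h0 : 0 < √(hA.1.eigenvalues i) := Real.sqrt_pos.2 (hpos i)
          have h1 := Real.mul_self_sqrt (hpos i).le
          field_simp
          rw [sq, h1]
  have hK' : (B * K * Bᵀ).PosSemidef := by
    have := hK.mul_mul_conjTranspose_same B
    rwa [conjTranspose_eq_transpose_of_trivial] at this
  have hs := hK'.1.spectral_theorem
  set V : Matrix ι ι ℝ := (hK'.1.eigenvectorUnitary : Matrix ι ι ℝ) with hV
  have hV1 : star V * V = 1 := Unitary.coe_star_mul_self _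
  have hVt : (star V)ᵀ = V := by
    rw [star_eq_conjTranspose, conjTranspose_eq_transpose_of_trivial, transpose_transpose]
  have hK2 : B * K * Bᵀ = V * diagonal hK'.1.eigenvalues * star V := by
    conv_lhs => rw [hs]
    rfl
  have hTA : star V * B * A * (star V * B)ᵀ = 1 := by
    rw [transpose_mul, hVt]
    calc _ = star V * (B * A * Bᵀ) * V := by simp only [Matrix.mul_assoc]
      _ = 1 := by rw [hB, Matrix.mul_one, hV1]
  refine ⟨star V * B, hK'.1.eigenvalues, hTA, ?_, ?_, hK'.eigenvalues_nonneg⟩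
  · rw [transpose_mul, hVt]
    calc _ = star V * (B * K * Bᵀ) * V := by simp only [Matrix.mul_assoc]
      _ = (star V * V) * diagonal hK'.1.eigenvalues * (star V * V) := by
          conv_lhs => rw [hK2]
          simp only [Matrix.mul_assoc]
      _ = _ := by rw [hV1, Matrix.one_mul, Matrix.mul_one]
  · symm
    apply inv_eq_left_inv
    rw [Matrix.mul_assoc]
    exact mul_eq_one_comm.1 hTA

/-- A trace bound for a transformed family of vectors which is close to a subspace. -/
theorem sum_norm_sq_le_of_approx {ι H : Type*} [Fintype ι] [NormedAddCommGroup H]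
    [InnerProductSpace ℝ H] (g : ι → H) (S : Submodule ℝ H) [FiniteDimensional ℝ S] (T : Matrix ι ι ℝ)
    (a b η : ℝ) (ha : 0 ≤ a) (hb : 0 ≤ b)
    (hT : ∀ c : ι → ℝ, ‖∑ r, c r • ∑ i, T r i • g i‖ ^ 2 ≤ a * ∑ r, c r ^ 2)
    (hTb : ∀ y : ι → ℝ, ∑ r, (∑ i, T r i * y i) ^ 2 ≤ b * ∑ i, y i ^ 2)
    (hS : ∀ i, ∃ p ∈ S, ‖g i - p‖ ^ 2 ≤ η) :
    ∑ r, ‖∑ i, T r i • g i‖ ^ 2 ≤ Module.finrank ℝ S * a + b * (Fintype.card ι * η) := by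
  set f : ι → H := fun r => ∑ i, T r i • g i with hf
  have hproj : ∀ r, ‖f r‖ ^ 2 = ‖S.starProjection (f r)‖ ^ 2 +
      ‖f r - S.starProjection (f r)‖ ^ 2 := by
    intro r
    rw [S.norm_sq_eq_add_norm_sq_starProjection (f r), S.starProjection_orthogonal_val]
  -- By `hT` the map c ↦ ∑ c_r f_r has squared norm at most a. So has its adjoint, and each vector
  -- of an orthonormal basis of `S` contributes at most a.
  have h1 : ∑ r, ‖S.starProjection (f r)‖ ^ 2 ≤ Module.finrank ℝ S * a := by
    set e := stdOrthonormalBasis ℝ S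
    have h2 : ∀ k, ∑ r, (inner ℝ (e k : H) (f r)) ^ 2 ≤ a := by
      intro k
      set s := ∑ r, (inner ℝ (e k : H) (f r)) ^ 2 with hs
      have h3 := hT fun r => inner ℝ (e k : H) (f r)
      have h4 : s = inner ℝ (e k : H) (∑ r, (inner ℝ (e k : H) (f r)) • f r) := by
        rw [inner_sum, hs]
        exact Finset.sum_congr rfl fun r _ => by rw [inner_smul_right, sq]
      have h5 : s ≤ ‖∑ r, (inner ℝ (e k : H) (f r)) • f r‖ := by
        rw [h4]
        refine (real_inner_le_norm _ _).trans ?_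
        have : ‖(e k : H)‖ = 1 := e.orthonormal.1 k
        rw [this, one_mul]
      have hs0 : 0 ≤ s := Finset.sum_nonneg fun _ _ => sq_nonneg _
      have h6 : s ^ 2 ≤ a * s := (pow_le_pow_left₀ hs0 h5 2).trans h3
      rcases hs0.eq_or_lt with h0 | h0
      · rw [← h0]; exact ha
      · exact le_of_mul_le_mul_right (by rwa [← sq]) h0
    have h3 : ∀ r, ‖S.starProjection (f r)‖ ^ 2 = ∑ k, (inner ℝ (e k : H) (f r)) ^ 2 := by
      intro r
      have h4 := e.sum_sq_inner_right (S.orthogonalProjectionOnto (f r))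
      rw [Submodule.starProjection_apply, Submodule.norm_coe, ← h4]
      refine Finset.sum_congr rfl fun k _ => ?_
      rw [Submodule.inner_orthogonalProjectionOnto_eq_of_mem_left]
    simp_rw [h3]
    rw [Finset.sum_comm]
    refine (Finset.sum_le_sum fun k _ => h2 k).trans_eq ?_
    simp
  -- The residuals of the f_r are the `T`-transforms of the residuals `q` of the g_i, so `hTb`
  -- applies to each coordinate in an orthonormal basis of their span.
  have h2 : ∑ r, ‖f r - S.starProjection (f r)‖ ^ 2 ≤ b * (Fintype.card ι * η) := by
    set q : ι → H := fun i => g i - S.starProjection (g i) with hq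
    have hq' : ∀ i, ‖q i‖ ^ 2 ≤ η := by
      intro i
      obtain ⟨p, hp, hpi⟩ := hS i
      refine le_trans ?_ hpi
      refine pow_le_pow_left₀ (norm_nonneg _) ?_ 2
      rw [hq]
      dsimp only
      rw [Submodule.starProjection_minimal]
      exact ciInf_le ⟨0, by rintro _ ⟨y, rfl⟩; positivity⟩ (⟨p, hp⟩ : S)
    have hfq : ∀ r, f r - S.starProjection (f r) = ∑ i, T r i • q i := by
      intro r
      simp only [hf, hq, map_sum, map_smul, smul_sub, Finset.sum_sub_distrib]
    set E := Submodule.span ℝ (Set.range q)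
    have hE : FiniteDimensional ℝ E := FiniteDimensional.span_of_finite ℝ (Set.finite_range q)
    set e := stdOrthonormalBasis ℝ E
    have hn : ∀ x ∈ E, ‖x‖ ^ 2 = ∑ k, (inner ℝ (e k : H) x) ^ 2 := by
      intro x hx
      exact (e.sum_sq_inner_right ⟨x, hx⟩).symm
    have hqE : ∀ i, q i ∈ E := fun i => Submodule.subset_span ⟨i, rfl⟩
    calc ∑ r, ‖f r - S.starProjection (f r)‖ ^ 2
        = ∑ r, ∑ k, (∑ i, T r i * inner ℝ (e k : H) (q i)) ^ 2 := by
          refine Finset.sum_congr rfl fun r _ => ?_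
          rw [hfq, hn _ (E.sum_mem fun i _ => E.smul_mem _ (hqE i))]
          simp_rw [inner_sum, inner_smul_right]
      _ = ∑ k, ∑ r, (∑ i, T r i * inner ℝ (e k : H) (q i)) ^ 2 := Finset.sum_comm
      _ ≤ ∑ k, b * ∑ i, (inner ℝ (e k : H) (q i)) ^ 2 := Finset.sum_le_sum fun k _ => hTb _
      _ = b * ∑ i, ‖q i‖ ^ 2 := by
          rw [← Finset.mul_sum, Finset.sum_comm]
          congr 1
          exact Finset.sum_congr rfl fun i _ => (hn _ (hqE i)).symm
      _ ≤ b * ∑ _i : ι, η := by gcongr; exact hq' _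
      _ = _ := by simp
  rw [Finset.sum_congr rfl fun r _ => hproj r, Finset.sum_add_distrib]
  exact add_le_add h1 h2

/-! ### Wiener integrals and their characteristic functions -/

/-- Finite linear combinations of the variables `W t`. -/
noncomputable def brownianComb {Ω : Type*} (W : ℝ≥0 → Ω → ℝ) : (ℝ≥0 →₀ ℝ) →ₗ[ℝ] (Ω → ℝ) :=
  Finsupp.linearCombination ℝ W

/-- Finite linear combinations of the indicators of `(0, t]`. -/
noncomputable def stepComb : (ℝ≥0 →₀ ℝ) →ₗ[ℝ] (ℝ → ℝ) :=
  Finsupp.linearCombination ℝ fun t : ℝ≥0 => (Ioc (0 : ℝ) t).indicator fun _ => (1 : ℝ)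

theorem brownianComb_apply {Ω : Type*} (W : ℝ≥0 → Ω → ℝ) (c : ℝ≥0 →₀ ℝ) :
    brownianComb W c = fun ω => ∑ t ∈ c.support, c t * W t ω := by
  ext ω
  simp [brownianComb, Finsupp.linearCombination_apply, Finsupp.sum]

theorem stepComb_apply (c : ℝ≥0 →₀ ℝ) :
    stepComb c = fun r => ∑ t ∈ c.support, c t * (Ioc (0 : ℝ) t).indicator (fun _ => (1 : ℝ)) r := by
  ext r
  simp [stepComb, Finsupp.linearCombination_apply, Finsupp.sum]

theorem memLp_indicator_Ioc (t : ℝ≥0) :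
    MemLp ((Ioc (0 : ℝ) t).indicator fun _ => (1 : ℝ)) 2 (volume.restrict (Ioi 0)) :=
  memLp_indicator_const 2 measurableSet_Ioc 1
    (Or.inr ((Measure.restrict_apply_le _ _).trans_lt measure_Ioc_lt_top).ne)

theorem memLp_stepComb (c : ℝ≥0 →₀ ℝ) : MemLp (stepComb c) 2 (volume.restrict (Ioi 0)) := by
  rw [stepComb_apply]
  exact memLp_finsetSum _ fun t _ => (memLp_indicator_Ioc t).const_mul _

/-- The indicators of (0, s] and (0, t] have inner product min s t, which is the Brownian
covariance. This is what makes `brownianComb` and `stepComb` isometric. -/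
theorem integral_stepComb_sq (c : ℝ≥0 →₀ ℝ) :
    ∫ r in Ioi (0 : ℝ), stepComb c r ^ 2 =
      ∑ s ∈ c.support, ∑ t ∈ c.support, c s * c t * (min s t : ℝ≥0) := by
  have h1 : ∀ r, stepComb c r ^ 2 = ∑ s ∈ c.support, ∑ t ∈ c.support,
      c s * c t * (Ioc (0 : ℝ) (min s t : ℝ≥0)).indicator (fun _ => (1 : ℝ)) r := by
    intro r
    rw [stepComb_apply, sq, Finset.sum_mul_sum]
    refine Finset.sum_congr rfl fun s _ => Finset.sum_congr rfl fun t _ => ?_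
    have : (Ioc (0 : ℝ) (min s t : ℝ≥0)) = Ioc (0 : ℝ) s ∩ Ioc (0 : ℝ) t := by
      rw [Ioc_inter_Ioc]; simp
    rw [this, ← Set.indicator_indicator]
    by_cases hs : r ∈ Ioc (0 : ℝ) s <;> by_cases ht : r ∈ Ioc (0 : ℝ) t <;> simp [hs, ht]
  have hi : ∀ u : ℝ≥0, IntegrableOn ((Ioc (0 : ℝ) u).indicator fun _ => (1 : ℝ)) (Ioi 0) :=
    fun u => by
      rw [IntegrableOn, integrable_indicator_iff measurableSet_Ioc]
      exact integrableOn_const ((Measure.restrict_apply_le _ _).trans_lt measure_Ioc_lt_top).ne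
  simp_rw [h1]
  rw [integral_finsetSum _ fun s _ => integrable_finsetSum _ fun t _ => (hi _).const_mul _]
  refine Finset.sum_congr rfl fun s _ => ?_
  rw [integral_finsetSum _ fun t _ => (hi _).const_mul _]
  refine Finset.sum_congr rfl fun t _ => ?_
  rw [integral_const_mul, integral_indicator measurableSet_Ioc,
    Measure.restrict_restrict measurableSet_Ioc, inter_eq_left.2 Ioc_subset_Ioi_self]
  simp

theorem map_brownianComb {Ω : Type*} [MeasurableSpace Ω] {P : Measure Ω} [IsProbabilityMeasure P]
    {W : ℝ≥0 → Ω → ℝ} (hW : IsBrownianReal W P) (c : ℝ≥0 →₀ ℝ) :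
    P.map (brownianComb W c) =
      gaussianReal 0 (∫ r in Ioi (0 : ℝ), stepComb c r ^ 2).toNNReal := by
  have hL : ∀ t, MemLp (W t) 2 P := fun t => (hW.hasLaw_eval t).hasGaussianLaw.memLp_two
  have hg : HasGaussianLaw (brownianComb W c) P := by
    rw [brownianComb_apply]
    exact (hW.isGaussianProcess.smul c).hasGaussianLaw_fun_sum
  rw [hg.map_eq_gaussianReal]
  congr 2
  · rw [brownianComb_apply, integral_finsetSum _ fun t _ => (hW.integrable_eval t).const_mul _]
    refine Finset.sum_eq_zero fun t _ => ?_
    rw [integral_const_mul, hW.integral_eval, mul_zero]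
  · rw [brownianComb_apply, variance_fun_sum' (fun t _ => (hL t).const_mul _), integral_stepComb_sq]
    refine Finset.sum_congr rfl fun s _ => Finset.sum_congr rfl fun t _ => ?_
    rw [covariance_const_mul_left, covariance_const_mul_right, hW.covariance_eval]
    ring

theorem memLp_brownianComb {Ω : Type*} [MeasurableSpace Ω] {P : Measure Ω} [IsProbabilityMeasure P]
    {W : ℝ≥0 → Ω → ℝ} (hW : IsBrownianReal W P) (c : ℝ≥0 →₀ ℝ) :
    MemLp (brownianComb W c) 2 P := by
  rw [brownianComb_apply]
  exact memLp_finsetSum _ fun t _ => (hW.hasLaw_eval t).hasGaussianLaw.memLp_two.const_mul _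

/-- The independent summand `N` is carried through from here on, so that the observation noise can
be added before any limit is taken. -/
theorem integral_cexp_brownianComb_add {Ω : Type*} [MeasurableSpace Ω] {P : Measure Ω}
    [IsProbabilityMeasure P] {W : ℝ≥0 → Ω → ℝ} (hW : IsBrownianReal W P) {N : Ω → ℝ}
    (hN : AEMeasurable N P) (hind : IndepFun (fun ω t => W t ω) N P) (c : ℝ≥0 →₀ ℝ) :
    ∫ ω, Complex.exp ((brownianComb W c ω + N ω : ℝ) * Complex.I) ∂P =
      Complex.exp (-((∫ r in Ioi (0 : ℝ), stepComb c r ^ 2 : ℝ) : ℂ) / 2) *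
        ∫ ω, Complex.exp (N ω * Complex.I) ∂P := by
  have hZ : AEMeasurable (brownianComb W c) P := (memLp_brownianComb hW c).1.aemeasurable
  have hi : IndepFun (brownianComb W c) N P := by
    rw [brownianComb_apply]
    exact hind.comp (φ := fun w : ℝ≥0 → ℝ => ∑ t ∈ c.support, c t * w t) (ψ := id)
      (by fun_prop) measurable_id
  have hcf : ∀ Z : Ω → ℝ, AEMeasurable Z P →
      charFun (P.map Z) 1 = ∫ ω, Complex.exp (Z ω * Complex.I) ∂P := by
    intro Z hZ
    rw [charFun_apply_real, integral_map hZ (by fun_prop)]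
    simp
  refine (hcf _ (hZ.add hN)).symm.trans ?_
  rw [hi.charFun_map_add_eq_mul hZ hN, Pi.mul_apply, hcf N hN,
    map_brownianComb hW, charFun_gaussianReal]
  congr 2
  rw [Real.coe_toNNReal _ (integral_nonneg fun _ => sq_nonneg _)]
  push_cast; ring

/-- `Z = ∫ f dW` for the deterministic square integrable function `f` on the half line, expressed
by simultaneous approximation. -/
structure IsWienerPair {Ω : Type*} [MeasurableSpace Ω] (P : Measure Ω) (W : ℝ≥0 → Ω → ℝ)
    (Z : Ω → ℝ) (f : ℝ → ℝ) : Prop where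
  memLp_left : MemLp Z 2 P
  memLp_right : MemLp f 2 (volume.restrict (Ioi 0))
  approx : ∀ δ : ℝ≥0∞, 0 < δ → ∃ c : ℝ≥0 →₀ ℝ, eLpNorm (Z - brownianComb W c) 2 P ≤ δ ∧
    eLpNorm (f - stepComb c) 2 (volume.restrict (Ioi 0)) ≤ δ

namespace IsWienerPair

variable {Ω : Type*} [MeasurableSpace Ω] {P : Measure Ω} {W : ℝ≥0 → Ω → ℝ} {Z Z' : Ω → ℝ}
  {f f' : ℝ → ℝ}

theorem zero : IsWienerPair P W 0 0 where
  memLp_left := MemLp.zero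
  memLp_right := MemLp.zero
  approx δ _ := ⟨0, by simp, by simp⟩

theorem add [IsProbabilityMeasure P] (hW : IsBrownianReal W P) (h : IsWienerPair P W Z f) (h' : IsWienerPair P W Z' f') :
    IsWienerPair P W (Z + Z') (f + f') where
  memLp_left := h.memLp_left.add h'.memLp_left
  memLp_right := h.memLp_right.add h'.memLp_right
  approx δ hδ := by
    have hδ2 : 0 < δ / 2 := ENNReal.half_pos hδ.ne'
    obtain ⟨c, hc1, hc2⟩ := h.approx _ hδ2
    obtain ⟨c', hc1', hc2'⟩ := h'.approx _ hδ2
    refine ⟨c + c', ?_, ?_⟩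
    · rw [map_add, add_sub_add_comm, ← ENNReal.add_halves δ]
      exact (eLpNorm_add_le (h.memLp_left.1.sub (memLp_brownianComb hW c).1)
        (h'.memLp_left.1.sub (memLp_brownianComb hW c').1) one_le_two).trans (add_le_add hc1 hc1')
    · rw [map_add, add_sub_add_comm, ← ENNReal.add_halves δ]
      exact (eLpNorm_add_le (h.memLp_right.1.sub (memLp_stepComb c).1)
        (h'.memLp_right.1.sub (memLp_stepComb c').1) one_le_two).trans (add_le_add hc2 hc2')

theorem const_smul (h : IsWienerPair P W Z f) (a : ℝ) : IsWienerPair P W (a • Z) (a • f) where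
  memLp_left := h.memLp_left.const_smul a
  memLp_right := h.memLp_right.const_smul a
  approx δ hδ := by
    -- The added 1 covers the case a = 0.
    obtain ⟨c, hc1, hc2⟩ := h.approx (δ / (‖a‖ₑ + 1))
      (ENNReal.div_pos hδ.ne' (by simp))
    have hle : ‖a‖ₑ * (δ / (‖a‖ₑ + 1)) ≤ δ :=
      (mul_le_mul_left (le_add_of_nonneg_right zero_le) _).trans ENNReal.mul_div_le
    refine ⟨a • c, ?_, ?_⟩
    · rw [map_smul, ← smul_sub, eLpNorm_const_smul]
      exact (mul_le_mul_right hc1 _).trans hle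
    · rw [map_smul, ← smul_sub, eLpNorm_const_smul]
      exact (mul_le_mul_right hc2 _).trans hle

theorem sum [IsProbabilityMeasure P] (hW : IsBrownianReal W P) {ι : Type*} (s : Finset ι) {Z : ι → Ω → ℝ}
    {f : ι → ℝ → ℝ} (h : ∀ i ∈ s, IsWienerPair P W (Z i) (f i)) :
    IsWienerPair P W (∑ i ∈ s, Z i) (∑ i ∈ s, f i) := by
  classical
  induction s using Finset.induction_on with
  | empty => simpa using zero
  | insert i s hi ih =>
    rw [Finset.sum_insert hi, Finset.sum_insert hi]
    exact (h i (Finset.mem_insert_self _ _)).add hW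
      (ih fun j hj => h j (Finset.mem_insert_of_mem hj))

end IsWienerPair

theorem norm_toLp_sq {α : Type*} [MeasurableSpace α] {μ : Measure α} {f : α → ℝ}
    (hf : MemLp f 2 μ) : ‖hf.toLp f‖ ^ 2 = ∫ x, f x ^ 2 ∂μ := by
  rw [← real_inner_self_eq_norm_sq, L2.inner_def]
  refine integral_congr_ae ?_
  filter_upwards [hf.coeFn_toLp] with x hx
  simp [hx, sq]

/-- Both sides pass to the limit along the simultaneous approximation: the variances by L²
convergence of the integrands, the expectations by almost sure convergence along a subsequence and
domination by 1. -/
theorem IsWienerPair.integral_cexp_add {Ω : Type*} [MeasurableSpace Ω] {P : Measure Ω}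
    [IsProbabilityMeasure P] {W : ℝ≥0 → Ω → ℝ} {Z : Ω → ℝ} {f : ℝ → ℝ}
    (hW : IsBrownianReal W P) {N : Ω → ℝ} (h : IsWienerPair P W Z f)
    (hN : AEMeasurable N P) (hind : IndepFun (fun ω t => W t ω) N P) :
    ∫ ω, Complex.exp ((Z ω + N ω : ℝ) * Complex.I) ∂P =
      Complex.exp (-((∫ r in Ioi (0 : ℝ), f r ^ 2 : ℝ) : ℂ) / 2) *
        ∫ ω, Complex.exp (N ω * Complex.I) ∂P := by
  choose c hc1 hc2 using fun k : ℕ => h.approx ((k : ℝ≥0∞) + 1)⁻¹ (by simp)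
  have hlim : Tendsto (fun k : ℕ => ((k : ℝ≥0∞) + 1)⁻¹) atTop (𝓝 0) := by
    have := ENNReal.tendsto_inv_nat_nhds_zero.comp (tendsto_add_atTop_nat 1)
    refine this.congr fun k => ?_
    simp
  have hZ : Tendsto (fun k => eLpNorm (brownianComb W (c k) - Z) 2 P) atTop (𝓝 0) := by
    refine tendsto_of_tendsto_of_tendsto_of_le_of_le tendsto_const_nhds hlim
      (fun _ => zero_le) fun k => ?_
    rw [eLpNorm_sub_comm]; exact hc1 k
  have hf : Tendsto (fun k => eLpNorm (stepComb (c k) - f) 2 (volume.restrict (Ioi 0))) atTop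
      (𝓝 0) := by
    refine tendsto_of_tendsto_of_tendsto_of_le_of_le tendsto_const_nhds hlim
      (fun _ => zero_le) fun k => ?_
    rw [eLpNorm_sub_comm]; exact hc2 k
  have hf2 : Tendsto (fun k => ∫ r in Ioi (0 : ℝ), stepComb (c k) r ^ 2) atTop
      (𝓝 (∫ r in Ioi (0 : ℝ), f r ^ 2)) := by
    have := (Lp.tendsto_Lp_iff_tendsto_eLpNorm'' _ (fun k => memLp_stepComb (c k)) _
      h.memLp_right).2 hf
    have h2 := (this.norm).pow 2
    simpa only [norm_toLp_sq] using h2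
  obtain ⟨ns, hns, hae⟩ := (tendstoInMeasure_of_tendsto_eLpNorm two_ne_zero
    (fun k => (memLp_brownianComb hW (c k)).1) h.memLp_left.1 hZ).exists_seq_tendsto_ae
  have hL : Tendsto (fun k => ∫ ω, Complex.exp ((brownianComb W (c (ns k)) ω + N ω : ℝ) *
      Complex.I) ∂P) atTop (𝓝 (∫ ω, Complex.exp ((Z ω + N ω : ℝ) * Complex.I) ∂P)) := by
    refine tendsto_integral_of_dominated_convergence (fun _ => 1) (fun k => ?_)
      (integrable_const _) (fun k => ae_of_all _ fun ω => ?_) ?_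
    · have : AEMeasurable (brownianComb W (c (ns k))) P :=
        (memLp_brownianComb hW (c (ns k))).1.aemeasurable
      exact AEMeasurable.aestronglyMeasurable (by fun_prop)
    · rw [Complex.norm_exp_ofReal_mul_I]
    · filter_upwards [hae] with ω hω
      have hc : Continuous fun x : ℝ => Complex.exp ((x + N ω : ℝ) * Complex.I) := by fun_prop
      exact (hc.tendsto (Z ω)).comp hω
  have hR : Tendsto (fun k => Complex.exp (-((∫ r in Ioi (0 : ℝ), stepComb (c (ns k)) r ^ 2 : ℝ)
      : ℂ) / 2) * ∫ ω, Complex.exp (N ω * Complex.I) ∂P) atTop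
      (𝓝 (Complex.exp (-((∫ r in Ioi (0 : ℝ), f r ^ 2 : ℝ) : ℂ) / 2) *
        ∫ ω, Complex.exp (N ω * Complex.I) ∂P)) := by
    have hc : Continuous fun x : ℝ => Complex.exp (-(x : ℂ) / 2) *
      ∫ ω, Complex.exp (N ω * Complex.I) ∂P := by fun_prop
    exact (hc.tendsto _).comp (hf2.comp hns.tendsto_atTop)
  refine tendsto_nhds_unique hL (hR.congr fun k => ?_)
  rw [integral_cexp_brownianComb_add hW hN hind]

theorem IsWienerIntegral.isWienerPair {Ω : Type*} [MeasurableSpace Ω] {P : Measure Ω}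
    {W : ℝ≥0 → Ω → ℝ} {f : ℝ → ℝ} {t : ℝ≥0} {Z : Ω → ℝ} (h : IsWienerIntegral P W f t Z) :
    IsWienerPair P W Z ((Ioc (0 : ℝ) t).indicator f) := by
  obtain ⟨h1, h2, h3⟩ := h
  have hres : (volume.restrict (Ioi (0 : ℝ))).restrict (Ioc (0 : ℝ) t) =
      volume.restrict (Ioc (0 : ℝ) t) := by
    rw [Measure.restrict_restrict measurableSet_Ioc, inter_eq_left.2 Ioc_subset_Ioi_self]
  refine ⟨h2, ?_, fun δ hδ => ?_⟩
  · rw [memLp_indicator_iff_restrict measurableSet_Ioc, hres]; exact h1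
  obtain ⟨m, s, c, hs, hst, hf, hZ⟩ := h3 δ hδ
  -- A step on (s k, s (k+1)] is a difference of indicators of intervals starting at 0, just as the
  -- increment of `W` is a difference of its values.
  set d : ℝ≥0 →₀ ℝ := ∑ k ∈ Finset.range m, c k • (Finsupp.single (s (k + 1)) 1 -
    Finsupp.single (s k) 1) with hd
  have hb : brownianComb W d = stepIntegral W m s c := by
    ext ω
    simp [hd, brownianComb, stepIntegral]
  have hstep : stepComb d = stepFunction m s c := by
    ext r
    simp only [hd, stepComb, stepFunction, map_sum, map_smul, map_sub,
      Finsupp.linearCombination_single, one_smul, Finset.sum_apply, Pi.smul_apply, Pi.sub_apply,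
      smul_eq_mul]
    refine Finset.sum_congr rfl fun k _ => ?_
    have h0 : (0 : ℝ) ≤ s k := (s k).2
    have h1 : (s k : ℝ) ≤ s (k + 1) := by exact_mod_cast hs (Nat.le_succ k)
    simp only [indicator_apply, mem_Ioc]
    grind
  refine ⟨d, ?_, ?_⟩
  · rw [hb]; exact hZ
  · have : (Ioc (0 : ℝ) t).indicator f - stepComb d =
        (Ioc (0 : ℝ) t).indicator fun r => f r - stepFunction m s c r := by
      ext r
      rw [hstep, Pi.sub_apply]
      by_cases hr : r ∈ Ioc (0 : ℝ) t
      · simp [hr]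
      · rw [indicator_of_notMem hr, indicator_of_notMem hr, stepFunction]
        rw [Finset.sum_eq_zero, sub_zero]
        intro k _
        refine indicator_of_notMem (fun hk => hr ⟨(s k).2.trans_lt hk.1, hk.2.trans ?_⟩) _
        exact_mod_cast hst _
    rw [this, eLpNorm_indicator_eq_eLpNorm_restrict measurableSet_Ioc, hres]
    exact hf

/-! ### The integrated process through Riemann sums -/

/-- With M = n(N+1) the right-endpoint sum is exactly the integral of x ↦ F(⌈xM⌉/M), and dominated
convergence applies. The mesh divides 1/n, so K/n is a grid point. Continuity almost everywhere
suffices, which covers both continuous paths and indicators of [s, ∞). -/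
theorem tendsto_riemannSum {F : ℝ → ℝ} (hF : Measurable F) {C : ℝ} (hC : ∀ x, |F x| ≤ C)
    (hcont : ∀ᵐ x, ContinuousAt F x) {n : ℕ} (hn : 0 < n) (K : ℕ) :
    Tendsto (fun N : ℕ => ∑ r ∈ Finset.range (K * (N + 1)),
      (1 / ((n : ℝ) * (N + 1))) * F (((r : ℝ) + 1) / (n * (N + 1)))) atTop
      (𝓝 (∫ x in (0 : ℝ)..(K : ℝ) / n, F x)) := by
  have hn' : (0 : ℝ) < n := by exact_mod_cast hn
  have hceil : ∀ M : ℝ, Measurable fun x : ℝ => F ((⌈x * M⌉ : ℝ) / M) := fun M =>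
    hF.comp (((measurable_from_top (f := fun z : ℤ => (z : ℝ))).comp
      (Int.measurable_ceil.comp (measurable_id.mul_const M))).div_const M)
  have hii : ∀ M a b : ℝ, IntervalIntegrable (fun x : ℝ => F ((⌈x * M⌉ : ℝ) / M)) volume a b := by
    intro M a b
    refine (intervalIntegrable_const (c := C)).mono_fun (hceil M).aestronglyMeasurable
      (ae_of_all _ fun x => ?_)
    exact ((hC _).trans (le_abs_self C))
  have heq : ∀ N : ℕ, ∑ r ∈ Finset.range (K * (N + 1)),
      (1 / ((n : ℝ) * (N + 1))) * F (((r : ℝ) + 1) / (n * (N + 1))) =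
      ∫ x in (0 : ℝ)..(K : ℝ) / n, F ((⌈x * (n * (N + 1))⌉ : ℝ) / (n * (N + 1))) := by
    intro N
    set M : ℝ := n * (N + 1) with hM
    have hM0 : 0 < M := by positivity
    have h1 := intervalIntegral.sum_integral_adjacent_intervals
      (a := fun r : ℕ => (r : ℝ) / M) (n := K * (N + 1)) (μ := volume)
      (f := fun x : ℝ => F ((⌈x * M⌉ : ℝ) / M)) (fun k _ => hii M _ _)
    have h2 : ((K * (N + 1) : ℕ) : ℝ) / M = K / n := by
      rw [hM]; push_cast; field_simp
    simp only [h2, Nat.cast_zero, zero_div] at h1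
    rw [← h1]
    refine Finset.sum_congr rfl fun r _ => ?_
    have hle : (r : ℝ) / M ≤ ((r + 1 : ℕ) : ℝ) / M := by gcongr; simp
    have h3 : ∫ x in (r : ℝ) / M..((r + 1 : ℕ) : ℝ) / M, F ((⌈x * M⌉ : ℝ) / M) =
        ∫ x in (r : ℝ) / M..((r + 1 : ℕ) : ℝ) / M, F (((r : ℝ) + 1) / M) := by
      rw [intervalIntegral.integral_of_le hle, intervalIntegral.integral_of_le hle]
      refine setIntegral_congr_fun measurableSet_Ioc fun x hx => ?_
      have : ⌈x * M⌉ = (r : ℤ) + 1 := by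
        rw [Int.ceil_eq_iff]
        have hx1 := (div_lt_iff₀ hM0).1 hx.1
        have hx2 := (le_div_iff₀ hM0).1 hx.2
        push_cast at hx2 ⊢
        constructor <;> linarith
      rw [this]; push_cast; rfl
    rw [h3, intervalIntegral.integral_const, smul_eq_mul]
    congr 1
    push_cast; field_simp; ring
  simp_rw [heq]
  refine intervalIntegral.tendsto_integral_filter_of_dominated_convergence (fun _ => C)
    (Eventually.of_forall fun N => (hceil _).aestronglyMeasurable)
    (Eventually.of_forall fun N => ae_of_all _ fun x _ => hC _) intervalIntegrable_const ?_
  filter_upwards [hcont] with x hx _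
  refine hx.tendsto.comp ?_
  have hlim : Tendsto (fun N : ℕ => x + 1 / ((n : ℝ) * (N + 1))) atTop (𝓝 x) := by
    have h1 : Tendsto (fun N : ℕ => (1 / (n : ℝ)) * (1 / ((N : ℝ) + 1))) atTop (𝓝 ((1 / n) * 0)) :=
      tendsto_one_div_add_atTop_nhds_zero_nat.const_mul _
    rw [mul_zero] at h1
    have h2 := h1.const_add x
    rw [add_zero] at h2
    refine h2.congr fun N => ?_
    rw [one_div_mul_one_div]
  refine tendsto_of_tendsto_of_tendsto_of_le_of_le tendsto_const_nhds hlim (fun N => ?_) fun N => ?_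
  · have hM0 : (0 : ℝ) < n * (N + 1) := by positivity
    exact (le_div_iff₀ hM0).2 (Int.le_ceil _)
  · have hM0 : (0 : ℝ) < n * (N + 1) := by positivity
    rw [div_le_iff₀ hM0, add_mul, one_div_mul_cancel hM0.ne']
    exact (Int.ceil_lt_add_one _).le

/-- The kernel `((i + 1) / n - s)₊` with `∫_0^{(i+1)/n} X_s ds = ∫ ramp n i dX`. -/
noncomputable def ramp (n : ℕ) (i : Fin n) (s : ℝ) : ℝ := max (((i : ℝ) + 1) / n - s) 0

theorem integral_indicator_Ici {s b : ℝ} (hs : 0 < s) (hb : 0 ≤ b) :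
    ∫ x in (0 : ℝ)..b, (Ici s).indicator (fun _ => (1 : ℝ)) x = max (b - s) 0 := by
  rw [intervalIntegral.integral_of_le hb, integral_indicator measurableSet_Ici,
    Measure.restrict_restrict measurableSet_Ici]
  have : Ici s ∩ Ioc 0 b = Icc s b := by
    ext x; simp only [mem_inter_iff, mem_Ici, mem_Ioc, mem_Icc]; grind
  rw [this]
  simp [Measure.real, ENNReal.toReal_ofReal']

section Law

variable {Ω : Type*} [MeasurableSpace Ω] {P : Measure Ω}
  {W : ℝ≥0 → Ω → ℝ} {σ : ℝ → ℝ} {X : ℝ≥0 → Ω → ℝ} {n : ℕ}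

theorem grid_le_one {n : ℕ} (i : Fin n) (N r : ℕ) (hr : r ∈ Finset.range ((i + 1) * (N + 1))) :
    ((r : ℝ) + 1) / (n * (N + 1)) ≤ 1 := by
  have hi := i.2
  have hn : 0 < n := by omega
  have hr' : r + 1 ≤ n * (N + 1) :=
    (Finset.mem_range.1 hr).trans_le (Nat.mul_le_mul_right _ (by omega))
  rw [div_le_one (by positivity)]
  exact_mod_cast hr'

theorem tendsto_riemannSum_path {x : ℝ≥0 → ℝ} (hx : ContinuousOn x (Icc 0 1)) (i : Fin n) :
    Tendsto (fun N : ℕ => ∑ r ∈ Finset.range ((i + 1) * (N + 1)),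
      (1 / ((n : ℝ) * (N + 1))) * x (((r : ℝ) + 1) / (n * (N + 1))).toNNReal) atTop
      (𝓝 (∫ s in (0 : ℝ)..((i : ℝ) + 1) / n, x s.toNNReal)) := by
  have hi := i.2
  have hn : 0 < n := by omega
  -- Freezing the path outside [0, 1] gives a bounded continuous function on the line that agrees
  -- with it at every time used.
  set F : ℝ → ℝ := fun s => x (min s.toNNReal 1) with hFdef
  have hF : Continuous F := hx.comp_continuous (by fun_prop) fun s => ⟨zero_le, min_le_right _ _⟩
  obtain ⟨C, hC⟩ := isCompact_Icc.exists_bound_of_continuousOn hx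
  have hFx : ∀ s : ℝ, s ≤ 1 → F s = x s.toNNReal := by
    intro s hs
    rw [hFdef]; dsimp only
    rw [min_eq_left (Real.toNNReal_le_one.2 hs)]
  have h := tendsto_riemannSum hF.measurable (C := C)
    (fun s => hC _ ⟨zero_le, min_le_right _ _⟩) (ae_of_all _ fun s => hF.continuousAt) hn (i + 1)
  have h1 : ∫ s in (0 : ℝ)..((i + 1 : ℕ) : ℝ) / n, F s =
      ∫ s in (0 : ℝ)..((i : ℝ) + 1) / n, x s.toNNReal := by
    push_cast
    refine intervalIntegral.integral_congr fun s hs => hFx s ?_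
    rw [uIcc_of_le (by positivity)] at hs
    refine hs.2.trans ?_
    rw [div_le_one (by positivity)]
    exact_mod_cast hi
  rw [h1] at h
  refine h.congr fun N => Finset.sum_congr rfl fun r hr => ?_
  rw [hFx _ (grid_le_one i N r hr)]

/-- No joint measurability of `X` in time and ω is assumed, so measurability is inherited from the
Riemann sums. -/
theorem aemeasurable_integral_process (hX : IsWienerIntegralProcess P W σ X) (i : Fin n) :
    AEMeasurable (fun ω => ∫ s in (0 : ℝ)..((i : ℝ) + 1) / n, X s.toNNReal ω) P := by
  refine aemeasurable_of_tendsto_metrizable_ae atTop (f := fun (N : ℕ) ω =>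
    ∑ r ∈ Finset.range ((i + 1) * (N + 1)),
      (1 / ((n : ℝ) * (N + 1))) * X (((r : ℝ) + 1) / (n * (N + 1))).toNNReal ω) (fun N => ?_) ?_
  · refine Finset.aemeasurable_fun_sum _ fun r hr => AEMeasurable.const_mul ?_ _
    exact (hX.isWienerIntegral _ (Real.toNNReal_le_one.2 (grid_le_one i N r hr))).2.1.1.aemeasurable
  · filter_upwards [hX.continuousOn] with ω hω
    exact tendsto_riemannSum_path hω i

/-- A stochastic Fubini argument. Equal Riemann sums of X_t and of the integrands 1_(0,t] σ form
Wiener pairs. The former converge to the integrated process by path continuity, the latter to σ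
times the ramps, with a uniform bound. -/
theorem integral_cexp_process [IsProbabilityMeasure P] (hW : IsBrownianReal W P) (hσ : ContinuousOn σ (Icc 0 1))
    (hX : IsWienerIntegralProcess P W σ X) {Y : Ω → ℝ} (hY : AEMeasurable Y P)
    (hind : IndepFun (fun ω t => W t ω) Y P) (u : Fin n → ℝ) :
    ∫ ω, Complex.exp ((∑ i, u i * (∫ s in (0 : ℝ)..((i : ℝ) + 1) / n, X s.toNNReal ω) + Y ω : ℝ) *
        Complex.I) ∂P =
      Complex.exp (-((∫ s in (0 : ℝ)..1, (σ s * ∑ i, u i * ramp n i s) ^ 2 : ℝ) : ℂ) / 2) *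
        ∫ ω, Complex.exp (Y ω * Complex.I) ∂P := by
  set R : ℕ → Ω → ℝ := fun N => ∑ i : Fin n, u i • ∑ r ∈ Finset.range ((i + 1) * (N + 1)),
    (1 / ((n : ℝ) * (N + 1))) • X (((r : ℝ) + 1) / (n * (N + 1))).toNNReal with hR
  set f : ℕ → ℝ → ℝ := fun N => ∑ i : Fin n, u i • ∑ r ∈ Finset.range ((i + 1) * (N + 1)),
    (1 / ((n : ℝ) * (N + 1))) •
      (Ioc (0 : ℝ) (((r : ℝ) + 1) / (n * (N + 1))).toNNReal).indicator σ with hf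
  have hpair : ∀ N, IsWienerPair P W (R N) (f N) := fun N =>
    IsWienerPair.sum hW _ fun i _ => (IsWienerPair.sum hW _ fun r hr =>
      ((hX.isWienerIntegral _
        (Real.toNNReal_le_one.2 (grid_le_one i N r hr))).isWienerPair).const_smul _).const_smul _
  have hcf := fun N => (hpair N).integral_cexp_add hW hY hind
  have hL : Tendsto (fun N => ∫ ω, Complex.exp ((R N ω + Y ω : ℝ) * Complex.I) ∂P) atTop
      (𝓝 (∫ ω, Complex.exp ((∑ i, u i * (∫ s in (0 : ℝ)..((i : ℝ) + 1) / n, X s.toNNReal ω) +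
        Y ω : ℝ) * Complex.I) ∂P)) := by
    refine tendsto_integral_of_dominated_convergence (fun _ => 1) (fun N => ?_)
      (integrable_const _) (fun N => ae_of_all _ fun ω => ?_) ?_
    · have : AEMeasurable (R N) P := (hpair N).memLp_left.1.aemeasurable
      exact AEMeasurable.aestronglyMeasurable (by fun_prop)
    · rw [Complex.norm_exp_ofReal_mul_I]
    · filter_upwards [hX.continuousOn] with ω hω
      have hc : Continuous fun x : ℝ => Complex.exp ((x + Y ω : ℝ) * Complex.I) := by fun_prop
      refine (hc.tendsto _).comp ?_
      have := tendsto_finsetSum Finset.univ fun i _ =>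
        (tendsto_riemannSum_path (n := n) hω i).const_mul (u i)
      refine this.congr fun N => ?_
      simp [hR]
  obtain ⟨B, hB⟩ := isCompact_Icc.exists_bound_of_continuousOn hσ
  -- For fixed s > 0, membership of s in (0, t] is the indicator of [s, ∞) evaluated at t. The
  -- integrand is thus itself a Riemann sum in t, with limit (t_i - s)₊ for t_i = (i+1)/n.
  have hfs : ∀ N s, s ∈ Ioc (0 : ℝ) 1 → f N s = σ s * ∑ i : Fin n, u i *
      ∑ r ∈ Finset.range ((i + 1) * (N + 1)), (1 / ((n : ℝ) * (N + 1))) *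
        (Ici s).indicator (fun _ => (1 : ℝ)) (((r : ℝ) + 1) / (n * (N + 1))) := by
    intro N s hs
    simp only [hf, Finset.sum_apply, Pi.smul_apply, smul_eq_mul, Finset.mul_sum]
    refine Finset.sum_congr rfl fun i _ => Finset.sum_congr rfl fun r _ => ?_
    have h0 : (0 : ℝ) ≤ ((r : ℝ) + 1) / (n * (N + 1)) := by positivity
    rw [Real.coe_toNNReal _ h0]
    simp only [indicator_apply, mem_Ioc, mem_Ici, hs.1, true_and]
    split_ifs <;> ring
  have hfs0 : ∀ N s, s ∉ Ioc (0 : ℝ) 1 → f N s = 0 := by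
    intro N s hs
    simp only [hf, Finset.sum_apply, Pi.smul_apply, smul_eq_mul]
    refine Finset.sum_eq_zero fun i _ => mul_eq_zero_of_right _
      (Finset.sum_eq_zero fun r hr => mul_eq_zero_of_right _ (indicator_of_notMem (fun h => hs ?_) _))
    have h0 : (0 : ℝ) ≤ ((r : ℝ) + 1) / (n * (N + 1)) := by positivity
    rw [Real.coe_toNNReal _ h0] at h
    exact ⟨h.1, h.2.trans (grid_le_one i N r hr)⟩
  have hint : ∀ N, ∫ s in Ioi (0 : ℝ), f N s ^ 2 = ∫ s in Ioc (0 : ℝ) 1, f N s ^ 2 := by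
    intro N
    refine (setIntegral_eq_of_subset_of_forall_sdiff_eq_zero measurableSet_Ioi
      Ioc_subset_Ioi_self fun s hs => ?_)
    rw [hfs0 N s hs.2]; ring
  have hbound : ∀ N, ∀ s ∈ Ioc (0 : ℝ) 1, |f N s| ≤ B * ∑ i, |u i| := by
    intro N s hs
    have hB0 : 0 ≤ B := (norm_nonneg _).trans (hB s ⟨hs.1.le, hs.2⟩)
    rw [hfs N s hs, abs_mul]
    refine mul_le_mul (hB s ⟨hs.1.le, hs.2⟩) ?_ (abs_nonneg _) hB0
    refine (Finset.abs_sum_le_sum_abs _ _).trans (Finset.sum_le_sum fun i _ => ?_)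
    have hi := i.2
    have hn : 0 < n := by omega
    have hn' : (0 : ℝ) < n := by exact_mod_cast hn
    rw [abs_mul]
    refine mul_le_of_le_one_right (abs_nonneg _) ?_
    rw [abs_of_nonneg (Finset.sum_nonneg fun r _ => mul_nonneg (by positivity)
      (indicator_nonneg (fun _ _ => zero_le_one) _))]
    calc _ ≤ ∑ r ∈ Finset.range ((i + 1) * (N + 1)), (1 / ((n : ℝ) * (N + 1))) * 1 := by
          refine Finset.sum_le_sum fun r _ => ?_
          gcongr
          exact indicator_le_self' (fun _ _ => zero_le_one) _
      _ = ((i : ℝ) + 1) / n := by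
          rw [Finset.sum_const, Finset.card_range, nsmul_eq_mul]; push_cast; field_simp
      _ ≤ 1 := by rw [div_le_one hn']; exact_mod_cast hi
  have hR2 : Tendsto (fun N => ∫ s in Ioi (0 : ℝ), f N s ^ 2) atTop
      (𝓝 (∫ s in (0 : ℝ)..1, (σ s * ∑ i, u i * ramp n i s) ^ 2)) := by
    simp_rw [hint]
    rw [intervalIntegral.integral_of_le zero_le_one]
    refine tendsto_integral_of_dominated_convergence (fun _ => (B * ∑ i, |u i|) ^ 2) (fun N => ?_)
      (integrable_const _) (fun N => ?_) ?_
    · exact ((hpair N).memLp_right.1.mono_measure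
        (Measure.restrict_mono Ioc_subset_Ioi_self le_rfl)).pow 2
    · refine (ae_restrict_iff' measurableSet_Ioc).2 (ae_of_all _ fun s hs => ?_)
      rw [Real.norm_eq_abs, abs_pow]
      exact pow_le_pow_left₀ (abs_nonneg _) (hbound N s hs) 2
    · refine (ae_restrict_iff' measurableSet_Ioc).2 (ae_of_all _ fun s hs => ?_)
      refine Tendsto.pow ?_ 2
      have h1 : ∀ i : Fin n, Tendsto (fun N : ℕ => u i *
          ∑ r ∈ Finset.range ((i + 1) * (N + 1)), (1 / ((n : ℝ) * (N + 1))) *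
          (Ici s).indicator (fun _ => (1 : ℝ)) (((r : ℝ) + 1) / (n * (N + 1)))) atTop
          (𝓝 (u i * ramp n i s)) := by
        intro i
        have hi := i.2
        have h := tendsto_riemannSum (F := (Ici s).indicator fun _ => (1 : ℝ)) (C := 1)
          (measurable_const.indicator measurableSet_Ici) (fun x => ?_) ?_ (n := n) (by omega)
          (i + 1)
        · rw [integral_indicator_Ici hs.1 (by positivity)] at h
          push_cast at h
          exact h.const_mul _
        · rw [abs_of_nonneg (indicator_nonneg (fun _ _ => zero_le_one) _)]
          exact indicator_le_self' (fun _ _ => zero_le_one) _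
        · have : ∀ᵐ x : ℝ, x ≠ s := by simp [ae_iff, measure_singleton]
          filter_upwards [this] with x hx
          rcases lt_or_gt_of_ne hx with h | h
          · refine ContinuousAt.congr (f := fun _ => (0 : ℝ)) continuousAt_const ?_
            filter_upwards [Iio_mem_nhds h] with y hy
            exact (indicator_of_notMem (notMem_Ici.2 hy) fun _ => (1 : ℝ)).symm
          · refine ContinuousAt.congr (f := fun _ => (1 : ℝ)) continuousAt_const ?_
            filter_upwards [Ioi_mem_nhds h] with y hy
            exact (indicator_of_mem (mem_Ici.2 (le_of_lt (mem_Ioi.1 hy))) fun _ => (1 : ℝ)).symm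
      refine ((tendsto_finsetSum Finset.univ fun i _ => h1 i).const_mul (σ s)).congr fun N => ?_
      rw [hfs N s hs]
  have hc : Continuous fun x : ℝ => Complex.exp (-(x : ℂ) / 2) *
      ∫ ω, Complex.exp (Y ω * Complex.I) ∂P := by fun_prop
  exact tendsto_nhds_unique hL (((hc.tendsto _).comp hR2).congr fun N => (hcf N).symm)

end Law

/-! ### Covariance matrices and the trace bound -/

theorem continuous_ramp (n : ℕ) (i : Fin n) : Continuous (ramp n i) := by
  unfold ramp; fun_prop

/-- The variance `∫_0^1 v (∑ u_i ramp_i)²` of a linear combination of the signal. -/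
noncomputable def covForm {n : ℕ} (v : ℝ → ℝ) (u : Fin n → ℝ) : ℝ :=
  ∫ s in (0 : ℝ)..1, v s * (∑ i, u i * ramp n i s) ^ 2

/-- The covariance matrix of the signal. -/
noncomputable def covMat (n : ℕ) (v : ℝ → ℝ) : Matrix (Fin n) (Fin n) ℝ :=
  Matrix.of fun i j => ∫ s in (0 : ℝ)..1, v s * (ramp n i s * ramp n j s)

/-- The covariance matrix of the observations. -/
noncomputable def obsMat (τ : ℝ) (n : ℕ) (v : ℝ → ℝ) : Matrix (Fin n) (Fin n) ℝ :=
  covMat n v + τ ^ 2 • (1 : Matrix (Fin n) (Fin n) ℝ)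

section Cov

open Matrix

variable {n : ℕ} {v w : ℝ → ℝ} {τ : ℝ}

theorem intervalIntegrable_of_continuousOn_Icc {f : ℝ → ℝ} (hf : ContinuousOn f (Icc 0 1)) :
    IntervalIntegrable f volume 0 1 :=
  ContinuousOn.intervalIntegrable (by rwa [uIcc_of_le zero_le_one])

theorem covForm_integrable (hv : ContinuousOn v (Icc 0 1)) (u : Fin n → ℝ) :
    IntervalIntegrable (fun s => v s * (∑ i, u i * ramp n i s) ^ 2) volume 0 1 := by
  have := continuous_ramp n
  exact intervalIntegrable_of_continuousOn_Icc (hv.mul (Continuous.continuousOn (by fun_prop)))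

theorem covForm_mono (hv : ContinuousOn v (Icc 0 1)) (hw : ContinuousOn w (Icc 0 1))
    (h : ∀ s ∈ Icc (0 : ℝ) 1, v s ≤ w s) (u : Fin n → ℝ) : covForm v u ≤ covForm w u :=
  intervalIntegral.integral_mono_on zero_le_one (covForm_integrable hv u) (covForm_integrable hw u)
    fun s hs => mul_le_mul_of_nonneg_right (h s hs) (sq_nonneg _)

theorem covForm_nonneg (h : ∀ s ∈ Icc (0 : ℝ) 1, 0 ≤ v s) (u : Fin n → ℝ) : 0 ≤ covForm v u :=
  intervalIntegral.integral_nonneg zero_le_one fun s hs => mul_nonneg (h s hs) (sq_nonneg _)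

theorem covForm_const_mul (c : ℝ) (u : Fin n → ℝ) :
    covForm (fun s => c * v s) u = c * covForm v u := by
  simp_rw [covForm, mul_assoc]
  rw [intervalIntegral.integral_const_mul]

theorem covMat_entry_integrable (hv : ContinuousOn v (Icc 0 1)) (i j : Fin n) :
    IntervalIntegrable (fun s => v s * (ramp n i s * ramp n j s)) volume 0 1 :=
  intervalIntegrable_of_continuousOn_Icc
    (hv.mul ((continuous_ramp n i).mul (continuous_ramp n j)).continuousOn)

theorem dotProduct_covMat (hv : ContinuousOn v (Icc 0 1)) (u : Fin n → ℝ) :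
    u ⬝ᵥ (covMat n v *ᵥ u) = covForm v u := by
  have h1 : ∀ s, v s * (∑ i, u i * ramp n i s) ^ 2 =
      ∑ i, ∑ j, (u i * u j) * (v s * (ramp n i s * ramp n j s)) := by
    intro s
    rw [sq, Finset.sum_mul_sum, Finset.mul_sum]
    refine Finset.sum_congr rfl fun i _ => ?_
    rw [Finset.mul_sum]
    exact Finset.sum_congr rfl fun j _ => by ring
  rw [covForm]
  simp_rw [h1]
  have hr := continuous_ramp n
  rw [intervalIntegral.integral_finsetSum fun i _ =>
    intervalIntegrable_of_continuousOn_Icc (by fun_prop)]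
  simp only [dotProduct, mulVec, covMat, of_apply]
  refine Finset.sum_congr rfl fun i _ => ?_
  rw [intervalIntegral.integral_finsetSum fun j _ => (covMat_entry_integrable hv i j).const_mul _,
    Finset.mul_sum]
  refine Finset.sum_congr rfl fun j _ => ?_
  rw [intervalIntegral.integral_const_mul]; ring

theorem dotProduct_obsMat (hv : ContinuousOn v (Icc 0 1)) (u : Fin n → ℝ) :
    u ⬝ᵥ (obsMat τ n v *ᵥ u) = covForm v u + τ ^ 2 * ∑ i, u i ^ 2 := by
  rw [obsMat, add_mulVec, dotProduct_add, dotProduct_covMat hv, smul_mulVec, one_mulVec,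
    dotProduct_smul, smul_eq_mul]
  simp only [dotProduct, sq]

theorem covMat_isHermitian : (covMat n v).IsHermitian := by
  ext i j
  simp only [covMat, conjTranspose_apply, of_apply, star_trivial]
  simp_rw [mul_comm (ramp n j _)]

theorem covMat_posSemidef (hv : ContinuousOn v (Icc 0 1)) (h : ∀ s ∈ Icc (0 : ℝ) 1, 0 ≤ v s) :
    (covMat n v).PosSemidef :=
  PosSemidef.of_dotProduct_mulVec_nonneg covMat_isHermitian fun u => by
    rw [star_trivial, dotProduct_covMat hv]; exact covForm_nonneg h u

theorem obsMat_posDef (hτ : 0 < τ) (hv : ContinuousOn v (Icc 0 1))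
    (h : ∀ s ∈ Icc (0 : ℝ) 1, 0 ≤ v s) : (obsMat τ n v).PosDef :=
  PosDef.posSemidef_add (covMat_posSemidef hv h) (PosDef.one.smul (by positivity))

theorem covMat_add (hv : ContinuousOn v (Icc 0 1)) (hw : ContinuousOn w (Icc 0 1)) :
    covMat n (fun s => v s + w s) = covMat n v + covMat n w := by
  ext i j
  simp only [covMat, of_apply, Matrix.add_apply, add_mul]
  exact intervalIntegral.integral_add (covMat_entry_integrable hv i j)
    (covMat_entry_integrable hw i j)

theorem covMat_sum {ι : Type*} (t : Finset ι) {f : ι → ℝ → ℝ}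
    (hf : ∀ k ∈ t, ContinuousOn (f k) (Icc 0 1)) :
    covMat n (fun s => ∑ k ∈ t, f k s) = ∑ k ∈ t, covMat n (f k) := by
  ext i j
  simp only [covMat, of_apply, Matrix.sum_apply, Finset.sum_mul]
  exact intervalIntegral.integral_finsetSum fun k hk => covMat_entry_integrable (hf k hk) i j

theorem mul_mul_transpose_apply_self (T A : Matrix (Fin n) (Fin n) ℝ) (r : Fin n) :
    (T * A * Tᵀ) r r = T r ⬝ᵥ (A *ᵥ T r) := by
  rw [Matrix.mul_assoc, mul_apply_eq_vecMul, vecMul_eq_sum]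
  simp [dotProduct, mul_apply, mulVec]

theorem dotProduct_mul_mul_transpose (T A : Matrix (Fin n) (Fin n) ℝ) (c : Fin n → ℝ) :
    c ⬝ᵥ ((T * A * Tᵀ) *ᵥ c) = (c ᵥ* T) ⬝ᵥ (A *ᵥ (c ᵥ* T)) := by
  rw [← mulVec_mulVec, ← mulVec_mulVec, mulVec_transpose, dotProduct_mulVec]

theorem memLp_restrict_Ioc_of_continuous {f : ℝ → ℝ} (hf : Continuous f) :
    MemLp f 2 (volume.restrict (Ioc (0 : ℝ) 1)) := by
  obtain ⟨B, hB⟩ := (isCompact_Icc (a := (0 : ℝ)) (b := 1)).exists_bound_of_continuousOn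
    hf.continuousOn
  refine MemLp.of_bound hf.aestronglyMeasurable B
    ((ae_restrict_iff' measurableSet_Ioc).2 (ae_of_all _ fun s hs => hB s ⟨hs.1.le, hs.2⟩))

/-- The elements of `L²(0,1]` represented by the kernels `ramp n i`. -/
noncomputable def rampLp (n : ℕ) (i : Fin n) : Lp ℝ 2 (volume.restrict (Ioc (0 : ℝ) 1)) :=
  (memLp_restrict_Ioc_of_continuous (continuous_ramp n i)).toLp _

theorem norm_sum_rampLp_sq (u : Fin n → ℝ) :
    ‖∑ i, u i • rampLp n i‖ ^ 2 = covForm (fun _ => 1) u := by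
  have hr := continuous_ramp n
  have hm : MemLp (fun s => ∑ i, u i * ramp n i s) 2 (volume.restrict (Ioc (0 : ℝ) 1)) :=
    memLp_restrict_Ioc_of_continuous (by fun_prop)
  have h1 : ∑ i, u i • rampLp n i = hm.toLp _ := by
    simp only [rampLp, ← MemLp.toLp_const_smul]
    have : ∀ s : Finset (Fin n), ∃ h : MemLp (fun s' => ∑ i ∈ s, u i * ramp n i s') 2
        (volume.restrict (Ioc (0 : ℝ) 1)), ∑ i ∈ s, MemLp.toLp (u i • ramp n i)
          ((memLp_restrict_Ioc_of_continuous (hr i)).const_smul _) = h.toLp _ := by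
      intro s
      refine ⟨memLp_restrict_Ioc_of_continuous (by fun_prop), ?_⟩
      induction s using Finset.induction_on with
      | empty => simp
      | insert i s hi ih =>
        rw [Finset.sum_insert hi, ih, ← MemLp.toLp_add]
        congr 1
        ext x; simp [Finset.sum_insert hi]
    exact (this Finset.univ).2
  rw [h1, norm_toLp_sq, covForm, intervalIntegral.integral_of_le zero_le_one]
  simp

/-- The indicator of `(-∞, k / M)` and its product with the identity, in `L²(0,1]`. -/
noncomputable def truncLp (M : ℕ) (p : Fin (M + 1) × Bool) :
    Lp ℝ 2 (volume.restrict (Ioc (0 : ℝ) 1)) :=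
  ((memLp_restrict_Ioc_of_continuous (f := fun s => if p.2 then s else 1)
    (by cases p.2 <;> simp <;> fun_prop)).indicator
      (measurableSet_Iio (a := (p.1 : ℝ) / M))).toLp _

/-- A ramp is linear up to its kink t and zero afterwards. Cutting it off at the grid point a =
⌊tM⌋/M leaves an error of size at most 1/M on an interval of length at most 1/M, whence M⁻³ for the
squared norm. -/
theorem exists_approx_rampLp {M : ℕ} (hM : 0 < M) (i : Fin n) :
    ∃ p ∈ Submodule.span ℝ (Set.range (truncLp M)), ‖rampLp n i - p‖ ^ 2 ≤ 1 / (M : ℝ) ^ 3 := by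
  have hM' : (0 : ℝ) < M := by exact_mod_cast hM
  have hi := i.2
  have hn : 0 < n := by omega
  set t : ℝ := ((i : ℝ) + 1) / n with ht
  have ht0 : 0 ≤ t := by positivity
  have ht1 : t ≤ 1 := by rw [ht, div_le_one (by positivity)]; exact_mod_cast hi
  set k := ⌊t * M⌋₊ with hk
  have hkM : k < M + 1 := by
    rw [Nat.lt_succ_iff]
    exact Nat.floor_le_of_le (by nlinarith)
  set a : ℝ := (k : ℝ) / M with ha
  have hat : a ≤ t := by
    rw [ha, div_le_iff₀ hM']; exact Nat.floor_le (by positivity)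
  have hta : t ≤ a + 1 / M := by
    rw [ha, ← add_div, le_div_iff₀ hM']; exact (Nat.lt_floor_add_one _).le
  refine ⟨t • truncLp M (⟨k, hkM⟩, false) - truncLp M (⟨k, hkM⟩, true), Submodule.sub_mem _
    (Submodule.smul_mem _ _ (Submodule.subset_span ⟨_, rfl⟩))
    (Submodule.subset_span ⟨_, rfl⟩), ?_⟩
  rw [rampLp, truncLp, truncLp, ← MemLp.toLp_const_smul, ← MemLp.toLp_sub, ← MemLp.toLp_sub,
    norm_toLp_sq]
  have hpt : ∀ s, (ramp n i - (t • (Iio (((⟨k, hkM⟩ : Fin (M + 1)) : ℝ) / M)).indicator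
      (fun s => if false = true then s else 1) - (Iio (((⟨k, hkM⟩ : Fin (M + 1)) : ℝ) / M)).indicator
      fun s => if true = true then s else 1)) s ^ 2 ≤
      (Icc a t).indicator (fun _ => 1 / (M : ℝ) ^ 2) s := by
    intro s
    simp only [Pi.sub_apply, Pi.smul_apply, smul_eq_mul, ramp, ← ht, ← ha, Bool.false_eq_true,
      if_false, if_true]
    rcases lt_or_ge s a with h | h
    · rw [indicator_of_mem (mem_Iio.2 h), indicator_of_mem (mem_Iio.2 h),
        indicator_of_notMem (fun h' : s ∈ Icc a t => h.not_ge h'.1), max_eq_left (by linarith)]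
      simp
    · rw [indicator_of_notMem (notMem_Iio.2 h), indicator_of_notMem (notMem_Iio.2 h)]
      rcases le_or_gt s t with h' | h'
      · rw [indicator_of_mem (show s ∈ Icc a t from ⟨h, h'⟩), max_eq_left (by linarith), mul_zero, sub_zero, sub_zero,
          ← _root_.one_div_pow]
        exact pow_le_pow_left₀ (by linarith) (by linarith) 2
      · rw [max_eq_right (by linarith), indicator_of_notMem (fun h'' : s ∈ Icc a t => h'.not_ge h''.2)]
        simp
  calc _ ≤ ∫ s in Ioc (0 : ℝ) 1, (Icc a t).indicator (fun _ => 1 / (M : ℝ) ^ 2) s := by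
        refine integral_mono_of_nonneg (ae_of_all _ fun s => sq_nonneg _) ?_ (ae_of_all _ hpt)
        exact (integrable_const _).indicator measurableSet_Icc
    _ ≤ ∫ s, (Icc a t).indicator (fun _ => 1 / (M : ℝ) ^ 2) s := by
        refine setIntegral_le_integral ?_ (ae_of_all _ fun s =>
          indicator_nonneg (fun _ _ => by positivity) _)
        exact (integrable_indicator_iff measurableSet_Icc).2
          (integrableOn_const measure_Icc_lt_top.ne)
    _ = (t - a) * (1 / (M : ℝ) ^ 2) := by
        rw [integral_indicator measurableSet_Icc]
        simp [Measure.real, ENNReal.toReal_ofReal (sub_nonneg.2 hat)]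
    _ ≤ (1 / M) * (1 / (M : ℝ) ^ 2) := by gcongr; linarith
    _ = _ := by field_simp

/-- For T with T Γ(v) Tᵀ = 1, the trace is a sum of squared norms of transformed ramps, weighted by
w ≤ δ. The signal part of Γ(v) controls the directions of the approximating space, the noise part τ²
I the approximation errors; `M` remains free. -/
theorem trace_inv_obsMat_mul_covMat_le {l δ : ℝ} (hτ : 0 < τ) (hl : 0 < l) (hδ : 0 ≤ δ)
    (hv : ContinuousOn v (Icc 0 1)) (hvl : ∀ s ∈ Icc (0 : ℝ) 1, l ≤ v s)
    (hw : ContinuousOn w (Icc 0 1)) (hwδ : ∀ s ∈ Icc (0 : ℝ) 1, w s ≤ δ) {M : ℕ} (hM : 0 < M) :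
    trace ((obsMat τ n v)⁻¹ * covMat n w) ≤
      δ * (2 * (M + 1) / l + n / (τ ^ 2 * (M : ℝ) ^ 3)) := by
  have hv0 : ∀ s ∈ Icc (0 : ℝ) 1, 0 ≤ v s := fun s hs => hl.le.trans (hvl s hs)
  -- Only the whitening matrix is needed, so the second matrix is a dummy.
  obtain ⟨T, -, hT, -, hTT, -⟩ := exists_simultaneous_diagonalization _ _
    (obsMat_posDef (n := n) hτ hv hv0) (obsMat_posDef (n := n) hτ hv hv0).posSemidef
  have htr : trace ((obsMat τ n v)⁻¹ * covMat n w) = ∑ r, covForm w (T r) := by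
    rw [← hTT, Matrix.mul_assoc, trace_mul_comm, trace]
    refine Finset.sum_congr rfl fun r _ => ?_
    rw [diag_apply, mul_mul_transpose_apply_self, dotProduct_covMat hw]
  have hc : ∀ c : Fin n → ℝ, covForm v (c ᵥ* T) + τ ^ 2 * ∑ i, (c ᵥ* T) i ^ 2 = ∑ r, c r ^ 2 := by
    intro c
    rw [← dotProduct_obsMat hv, ← dotProduct_mul_mul_transpose, hT, one_mulVec]
    simp only [dotProduct, sq]
  have hlow : ∀ u : Fin n → ℝ, l * covForm (fun _ => 1) u ≤ covForm v u := by
    intro u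
    rw [← covForm_const_mul]
    exact covForm_mono continuousOn_const hv (fun s hs => by simpa using hvl s hs) u
  have hfin : FiniteDimensional ℝ (Submodule.span ℝ (Set.range (truncLp M))) :=
    FiniteDimensional.span_of_finite ℝ (Set.finite_range _)
  have hmain := sum_norm_sq_le_of_approx (rampLp n) (Submodule.span ℝ (Set.range (truncLp M))) T
    (1 / l) (1 / τ ^ 2) (1 / (M : ℝ) ^ 3) (by positivity) (by positivity) ?_ ?_
    (exists_approx_rampLp hM)
  · simp_rw [norm_sum_rampLp_sq] at hmain
    have hrank : (Module.finrank ℝ (Submodule.span ℝ (Set.range (truncLp M))) : ℝ) ≤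
        2 * (M + 1) := by
      have h := finrank_range_le_card (R := ℝ) (truncLp M)
      simp only [Fintype.card_prod, Fintype.card_fin, Fintype.card_bool] at h
      calc _ ≤ (((M + 1) * 2 : ℕ) : ℝ) := by exact_mod_cast h
        _ = _ := by push_cast; ring
    rw [htr]
    calc ∑ r, covForm w (T r) ≤ ∑ r, δ * covForm (fun _ => 1) (T r) := by
          refine Finset.sum_le_sum fun r _ => ?_
          rw [← covForm_const_mul]
          exact covForm_mono hw continuousOn_const (fun s hs => by simpa using hwδ s hs) _
      _ = δ * ∑ r, covForm (fun _ => 1) (T r) := by rw [Finset.mul_sum]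
      _ ≤ δ * (2 * (M + 1) * (1 / l) + 1 / τ ^ 2 * (Fintype.card (Fin n) * (1 / (M : ℝ) ^ 3))) := by
          refine mul_le_mul_of_nonneg_left (hmain.trans ?_) hδ
          gcongr
      _ = _ := by
          rw [Fintype.card_fin]
          have hM' : (0 : ℝ) < M := by exact_mod_cast hM
          field_simp
  -- Dropping the noise term in `hc` and using v ≥ l gives the constant 1/l.
  · intro c
    have h1 : ∑ r, c r • ∑ i, T r i • rampLp n i = ∑ i, (c ᵥ* T) i • rampLp n i := by
      simp_rw [Finset.smul_sum, smul_smul, vecMul, dotProduct, Finset.sum_smul]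
      exact Finset.sum_comm
    rw [h1, norm_sum_rampLp_sq, one_div_mul_eq_div, le_div_iff₀ hl, mul_comm, ← hc c]
    exact (hlow _).trans (le_add_of_nonneg_right (by positivity))
  -- Dropping the signal term in `hc` bounds Tᵀ by 1/τ. Cauchy–Schwarz applied to |Ty|² = ⟨y, TᵀTy⟩
  -- transfers this to T.
  · intro y
    set s := ∑ r, (∑ i, T r i * y i) ^ 2 with hs
    have hs0 : 0 ≤ s := Finset.sum_nonneg fun _ _ => sq_nonneg _
    have h1 : s = ∑ i, y i * ((T *ᵥ y) ᵥ* T) i := by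
      have h2 : s = (T *ᵥ y) ⬝ᵥ (T *ᵥ y) := by simp only [hs, dotProduct, mulVec, sq]
      rw [h2, dotProduct_mulVec, dotProduct_comm]; rfl
    have h2 : τ ^ 2 * ∑ i, ((T *ᵥ y) ᵥ* T) i ^ 2 ≤ s := by
      have h3 := hc (T *ᵥ y)
      have h4 : ∑ r, (T *ᵥ y) r ^ 2 = s := rfl
      rw [h4] at h3
      have := covForm_nonneg hv0 ((T *ᵥ y) ᵥ* T)
      linarith
    have h3 : s ^ 2 ≤ (∑ i, y i ^ 2) * ∑ i, ((T *ᵥ y) ᵥ* T) i ^ 2 := by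
      rw [h1]; exact Finset.sum_mul_sq_le_sq_mul_sq _ _ _
    rw [one_div_mul_eq_div, le_div_iff₀ (by positivity)]
    rcases hs0.eq_or_lt with h0 | h0
    · rw [← h0, zero_mul]; exact Finset.sum_nonneg fun _ _ => sq_nonneg _
    · have hy : 0 ≤ ∑ i, y i ^ 2 := Finset.sum_nonneg fun _ _ => sq_nonneg _
      refine le_of_mul_le_mul_right ?_ h0
      nlinarith [mul_le_mul_of_nonneg_left h2 hy, mul_le_mul_of_nonneg_left h3 (sq_nonneg τ)]

end Cov

/-! ### Law of the observations and the two-point bound -/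

section Observation

open Matrix

variable {Ω : Type*} [MeasurableSpace Ω] {P : Measure Ω}
  {W : ℝ≥0 → Ω → ℝ} {ε : (n : ℕ) → Fin n → Ω → ℝ} {X : (ℝ → ℝ) → ℝ≥0 → Ω → ℝ} {τ : ℝ} {n : ℕ}
  {v h : ℝ → ℝ}

theorem process_sqrt (hM : IsNoisyVolatilityModel P W ε X) (hv : ContinuousOn v (Icc 0 1))
    (hv0 : ∀ s ∈ Icc (0 : ℝ) 1, 0 < v s) :
    IsWienerIntegralProcess P W (fun s => √(v s)) (X fun s => √(v s)) :=
  hM.process _ hv.sqrt fun s hs => Real.sqrt_pos.2 (hv0 s hs)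

theorem aemeasurable_observation (hM : IsNoisyVolatilityModel P W ε X)
    (hv : ContinuousOn v (Icc 0 1)) (hv0 : ∀ s ∈ Icc (0 : ℝ) 1, 0 < v s) :
    AEMeasurable (integratedObservation τ n (X fun s => √(v s)) (ε n)) P :=
  aemeasurable_pi_lambda _ fun i => (aemeasurable_integral_process (process_sqrt hM hv hv0) i).add
    ((hM.noise_law n i).aemeasurable.const_mul τ)

theorem integral_cexp_observation [IsProbabilityMeasure P] (hM : IsNoisyVolatilityModel P W ε X)
    (hv : ContinuousOn v (Icc 0 1)) (hv0 : ∀ s ∈ Icc (0 : ℝ) 1, 0 < v s) (u : Fin n → ℝ) :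
    ∫ ω, Complex.exp ((∑ i, u i * integratedObservation τ n (X fun s => √(v s)) (ε n) ω i : ℝ) *
        Complex.I) ∂P =
      Complex.exp (-((u ⬝ᵥ (obsMat τ n v *ᵥ u) : ℝ) : ℂ) / 2) := by
  have hε : ∀ i, AEMeasurable (ε n i) P := fun i => (hM.noise_law n i).aemeasurable
  set Y : Ω → ℝ := fun ω => ∑ i, τ * u i * ε n i ω with hYdef
  have hY : AEMeasurable Y P := by fun_prop
  have hind : IndepFun (fun ω t => W t ω) Y P :=
    (hM.indep n).comp (φ := id) (ψ := fun e : Fin n → ℝ => ∑ i, τ * u i * e i) measurable_id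
      (by fun_prop)
  have hlaw := (hM.noise_indep n).hasLaw_pi (hM.noise_law n)
  have hYcf : ∫ ω, Complex.exp (Y ω * Complex.I) ∂P =
      Complex.exp (-((τ ^ 2 * ∑ i, u i ^ 2 : ℝ) : ℂ) / 2) := by
    have h1 := integral_cexp_pi_gaussian (fun _ : Fin n => 1) fun i => τ * u i
    rw [← hlaw.map_eq, integral_map hlaw.aemeasurable
      (Continuous.aestronglyMeasurable (by fun_prop))] at h1
    refine h1.trans ?_
    congr 4
    rw [Finset.mul_sum]
    exact Finset.sum_congr rfl fun i _ => by simp; ring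
  have hmain := integral_cexp_process (n := n) hM.brownian hv.sqrt (process_sqrt hM hv hv0) hY
    hind u
  have h2 : ∀ ω, ∑ i, u i * integratedObservation τ n (X fun s => √(v s)) (ε n) ω i =
      ∑ i, u i * (∫ s in (0 : ℝ)..((i : ℝ) + 1) / n, X (fun s => √(v s)) s.toNNReal ω) + Y ω := by
    intro ω
    rw [hYdef, ← Finset.sum_add_distrib]
    exact Finset.sum_congr rfl fun i _ => by rw [integratedObservation]; ring
  simp_rw [h2]
  rw [hmain, hYcf, ← Complex.exp_add, dotProduct_obsMat hv]
  have h3 : ∫ s in (0 : ℝ)..1, (√(v s) * ∑ i, u i * ramp n i s) ^ 2 = covForm v u := by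
    refine intervalIntegral.integral_congr fun s hs => ?_
    rw [uIcc_of_le zero_le_one] at hs
    rw [mul_pow, Real.sq_sqrt (hv0 s hs).le]
  rw [h3]
  congr 1
  push_cast; ring

theorem map_mulVec_observation [IsProbabilityMeasure P] (hM : IsNoisyVolatilityModel P W ε X)
    (hv : ContinuousOn v (Icc 0 1)) (hv0 : ∀ s ∈ Icc (0 : ℝ) 1, 0 < v s)
    (T : Matrix (Fin n) (Fin n) ℝ) (d : Fin n → ℝ≥0)
    (hT : T * obsMat τ n v * Tᵀ = diagonal fun i => (d i : ℝ)) :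
    P.map (fun ω => T *ᵥ integratedObservation τ n (X fun s => √(v s)) (ε n) ω) =
      Measure.pi fun i => gaussianReal 0 (d i) := by
  have hY := aemeasurable_observation (τ := τ) (n := n) hM hv hv0
  have hTm : Measurable fun y : Fin n → ℝ => T *ᵥ y := by
    unfold mulVec dotProduct; fun_prop
  have hTY := hTm.comp_aemeasurable hY
  have : IsProbabilityMeasure (P.map fun ω =>
      T *ᵥ integratedObservation τ n (X fun s => √(v s)) (ε n) ω) :=
    Measure.isProbabilityMeasure_map hTY
  refine measure_ext_of_integral_cexp _ _ fun u => ?_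
  rw [integral_cexp_pi_gaussian]
  refine (integral_map hTY (Continuous.aestronglyMeasurable (by fun_prop))).trans ?_
  have h1 : ∀ y : Fin n → ℝ, ∑ i, u i * (T *ᵥ y) i = ∑ i, (u ᵥ* T) i * y i :=
    fun y => dotProduct_mulVec u T y
  simp_rw [Function.comp_apply, h1]
  rw [integral_cexp_observation hM hv hv0, ← dotProduct_mul_mul_transpose, hT]
  congr 4
  simp only [dotProduct, mulVec_diagonal]
  exact Finset.sum_congr rfl fun i _ => by ring

/-- Two-point lower bound for observations with volatility `v` and `v + h`, where `0 ≤ h ≤ κ v`. -/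
theorem two_point_observation [IsProbabilityMeasure P] (hτ : 0 < τ)
    (hM : IsNoisyVolatilityModel P W ε X)
    (hv : ContinuousOn v (Icc 0 1)) (hv0 : ∀ s ∈ Icc (0 : ℝ) 1, 0 < v s)
    (hh : ContinuousOn h (Icc 0 1)) (hh0 : ∀ s ∈ Icc (0 : ℝ) 1, 0 ≤ h s) {κ : ℝ} (hκ : 0 ≤ κ)
    (hhκ : ∀ s ∈ Icc (0 : ℝ) 1, h s ≤ κ * v s) (est : (Fin n → ℝ) → ℝ) (hest : Measurable est)
    (a b : ℝ) :
    ENNReal.ofReal ((a - b) ^ 2 / 2 *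
        (1 - κ / 8 * trace ((obsMat τ n v)⁻¹ * covMat n h))) ≤
      ∫⁻ ω, ENNReal.ofReal
        ((est (integratedObservation τ n (X fun s => √(v s)) (ε n) ω) - a) ^ 2) ∂P +
      ∫⁻ ω, ENNReal.ofReal
        ((est (integratedObservation τ n (X fun s => √(v s + h s)) (ε n) ω) - b) ^ 2) ∂P := by
  have hv0' : ∀ s ∈ Icc (0 : ℝ) 1, 0 ≤ v s := fun s hs => (hv0 s hs).le
  obtain ⟨T, d, hTA, hTK, hTT, hd⟩ := exists_simultaneous_diagonalization _ _
    (obsMat_posDef (n := n) hτ hv hv0') (covMat_posSemidef (n := n) hh hh0)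
  lift d to Fin n → ℝ≥0 using hd
  have hvh : ContinuousOn (fun s => v s + h s) (Icc 0 1) := hv.add hh
  have hvh0 : ∀ s ∈ Icc (0 : ℝ) 1, 0 < v s + h s := fun s hs =>
    add_pos_of_pos_of_nonneg (hv0 s hs) (hh0 s hs)
  have hmap0 := map_mulVec_observation hM hv hv0 T (fun _ => 1) (by rw [hTA]; simp)
  have hmap1 := map_mulVec_observation (τ := τ) hM hvh hvh0 T (fun i => 1 + d i) (by
    have : obsMat τ n (fun s => v s + h s) = obsMat τ n v + covMat n h := by
      rw [obsMat, obsMat, covMat_add hv hh]; abel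
    rw [this, Matrix.mul_add, Matrix.add_mul, hTA, hTK, ← diagonal_one, diagonal_add]
    simp)
  -- `T` is invertible, so an estimator based on Y is an estimator based on T Y and whitening loses
  -- nothing.
  have hTu : IsUnit T.det := by
    have h1 := congrArg det hTA
    rw [det_mul, det_mul, det_one, mul_assoc] at h1
    exact IsUnit.of_mul_eq_one _ h1
  have hinv : ∀ y : Fin n → ℝ, T⁻¹ *ᵥ (T *ᵥ y) = y := fun y => by
    rw [mulVec_mulVec, nonsing_inv_mul _ hTu, one_mulVec]
  have hmeas : ∀ S : Matrix (Fin n) (Fin n) ℝ, Measurable fun y : Fin n → ℝ => S *ᵥ y := by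
    intro S; unfold mulVec dotProduct; fun_prop
  have hf : Measurable fun y => est (T⁻¹ *ᵥ y) := hest.comp (hmeas _)
  have htp := two_point_pi_gaussian d (fun y => est (T⁻¹ *ᵥ y)) hf a b
  have hY0 := (hmeas T).comp_aemeasurable (aemeasurable_observation (τ := τ) (n := n) hM hv hv0)
  have hY1 := (hmeas T).comp_aemeasurable (aemeasurable_observation (τ := τ) (n := n) hM hvh hvh0)
  rw [← hmap0, ← hmap1] at htp
  have e0 := lintegral_map' (μ := P) (f := fun y => ENNReal.ofReal ((est (T⁻¹ *ᵥ y) - a) ^ 2))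
    (((hf.sub_const a).pow_const 2).ennreal_ofReal.aemeasurable) hY0
  have e1 := lintegral_map' (μ := P) (f := fun y => ENNReal.ofReal ((est (T⁻¹ *ᵥ y) - b) ^ 2))
    (((hf.sub_const b).pow_const 2).ennreal_ofReal.aemeasurable) hY1
  simp only [Function.comp_def, hinv] at e0 e1
  rw [e0, e1] at htp
  refine le_trans (ENNReal.ofReal_le_ofReal ?_) htp
  have hdr : ∀ r, (d r : ℝ) = covForm h (T r) := by
    intro r
    rw [← dotProduct_covMat hh, ← mul_mul_transpose_apply_self, hTK, diagonal_apply_eq]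
  -- Each whitened coordinate has total variance 1, so its signal part is at most 1, and h ≤ κ v
  -- bounds the perturbation by κ.
  have hdκ : ∀ r, (d r : ℝ) ≤ κ := by
    intro r
    have h1 : covForm v (T r) + τ ^ 2 * ∑ i, T r i ^ 2 = 1 := by
      rw [← dotProduct_obsMat hv, ← mul_mul_transpose_apply_self, hTA, one_apply_eq]
    have h2 : covForm h (T r) ≤ κ * covForm v (T r) := by
      rw [← covForm_const_mul]
      exact covForm_mono hh (hv.const_mul κ) hhκ _
    have h3 : 0 ≤ τ ^ 2 * ∑ i, T r i ^ 2 := by positivity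
    rw [hdr]
    nlinarith
  have htr : trace ((obsMat τ n v)⁻¹ * covMat n h) = ∑ r, (d r : ℝ) := by
    rw [← hTT, Matrix.mul_assoc, trace_mul_comm, hTK, trace_diagonal]
  have hsum : ∑ r, (d r : ℝ) ^ 2 ≤ κ * ∑ r, (d r : ℝ) := by
    rw [Finset.mul_sum]
    refine Finset.sum_le_sum fun r _ => ?_
    rw [sq]
    exact mul_le_mul_of_nonneg_right (hdκ r) (d r).2
  rw [htr, mul_div_right_comm]
  refine mul_le_mul_of_nonneg_left ?_ (by positivity)
  have := Real.add_one_le_exp (-(∑ i, (d i : ℝ) ^ 2) / 8)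
  linarith

end Observation

/-! ### Bump functions in the Hölder class -/

/-- A smooth bump supported in `[1/4, 3/4]` and equal to `1` on `[3/8, 5/8]`. -/
noncomputable def unitBump : ContDiffBump (1 / 2 : ℝ) := ⟨1 / 8, 1 / 4, by norm_num, by norm_num⟩

theorem contDiff_unitBump : ContDiff ℝ (⊤ : ℕ∞) unitBump := unitBump.contDiff

theorem hasDerivAt_iteratedDeriv_unitBump (k : ℕ) (y : ℝ) :
    HasDerivAt (iteratedDeriv k unitBump) (iteratedDeriv (k + 1) unitBump y) y := by
  rw [iteratedDeriv_succ]
  exact ((contDiff_unitBump.differentiable_iteratedDeriv k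
    (by exact_mod_cast WithTop.coe_lt_top _)) y).hasDerivAt

theorem iteratedDeriv_unitBump_eq_zero (k : ℕ) {y : ℝ} (hy : y ∉ Icc (1 / 4 : ℝ) (3 / 4)) :
    iteratedDeriv k unitBump y = 0 := by
  have hsub : tsupport (iteratedDeriv k unitBump) ⊆ tsupport unitBump := by
    induction k with
    | zero => simp
    | succ k ih => rw [iteratedDeriv_succ]; exact tsupport_deriv_subset.trans ih
  refine image_eq_zero_of_notMem_tsupport fun h => hy ?_
  have h1 := hsub h
  rw [unitBump.tsupport_eq, Real.closedBall_eq_Icc] at h1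
  simp only [unitBump] at h1
  constructor <;> [have := h1.1; have := h1.2] <;> linarith

theorem exists_bound_iteratedDeriv_unitBump (k : ℕ) :
    ∃ B, 0 < B ∧ ∀ y, |iteratedDeriv k unitBump y| ≤ B := by
  obtain ⟨B, hB⟩ := (isCompact_Icc (a := (1 / 4 : ℝ)) (b := 3 / 4)).exists_bound_of_continuousOn
    (f := iteratedDeriv k unitBump)
    fun y _ => (hasDerivAt_iteratedDeriv_unitBump k y).continuousAt.continuousWithinAt
  refine ⟨max B 1, by positivity, fun y => ?_⟩
  by_cases hy : y ∈ Icc (1 / 4 : ℝ) (3 / 4)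
  · exact (hB y hy).trans (le_max_left _ _)
  · rw [iteratedDeriv_unitBump_eq_zero k hy, abs_zero]; positivity

/-- Integer translates of a function supported in [1/4, 3/4] have disjoint supports, so at most one
term is nonzero and the bound does not depend on the number of bumps. -/
theorem abs_sum_translates_le {g : ℝ → ℝ} {B : ℝ} (hg : ∀ y, |g y| ≤ B)
    (h0 : ∀ y, y ∉ Icc (1 / 4 : ℝ) (3 / 4) → g y = 0) {m : ℕ} (s : Finset (Fin m)) (y : ℝ) :
    |∑ j ∈ s, g (y - j)| ≤ B := by
  by_cases h : ∃ j ∈ s, g (y - j) ≠ 0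
  · obtain ⟨j, hj, hne⟩ := h
    rw [Finset.sum_eq_single_of_mem j hj]
    · exact hg _
    · intro i _ hij
      refine h0 _ fun hi => hij ?_
      have hj' : y - j ∈ Icc (1 / 4 : ℝ) (3 / 4) := by
        by_contra hcon; exact hne (h0 _ hcon)
      have h1 : ((i : ℕ) : ℝ) < (j : ℕ) + 1 := by linarith [hi.1, hj'.2]
      have h2 : ((j : ℕ) : ℝ) < (i : ℕ) + 1 := by linarith [hi.2, hj'.1]
      have h1' : (i : ℕ) < j + 1 := by exact_mod_cast h1
      have h2' : (j : ℕ) < i + 1 := by exact_mod_cast h2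
      exact Fin.ext (by omega)
  · push Not at h
    rw [Finset.sum_eq_zero h, abs_zero]
    exact (abs_nonneg _).trans (hg 0)

/-- The `j`-th bump of height `A` on the grid of mesh `1 / m`. -/
noncomputable def bumpPiece (A : ℝ) (m j : ℕ) (x : ℝ) : ℝ := A * unitBump (m * x - j)

/-- The function `l` plus the bumps with index in `s`. -/
noncomputable def bumpFun (l A : ℝ) {m : ℕ} (s : Finset (Fin m)) (x : ℝ) : ℝ :=
  l + ∑ j ∈ s, bumpPiece A m j x

theorem continuous_bumpPiece (A : ℝ) (m j : ℕ) : Continuous (bumpPiece A m j) := by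
  have := unitBump.continuous
  unfold bumpPiece; fun_prop

theorem bumpPiece_nonneg {A : ℝ} (hA : 0 ≤ A) (m j : ℕ) (x : ℝ) : 0 ≤ bumpPiece A m j x :=
  mul_nonneg hA unitBump.nonneg

theorem bumpPiece_le {A : ℝ} (hA : 0 ≤ A) (m j : ℕ) (x : ℝ) : bumpPiece A m j x ≤ A :=
  mul_le_of_le_one_right hA unitBump.le_one

theorem sum_bumpPiece_le {A : ℝ} (hA : 0 ≤ A) {m : ℕ} (s : Finset (Fin m)) (x : ℝ) :
    ∑ j ∈ s, bumpPiece A m j x ≤ A := by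
  simp only [bumpPiece, ← Finset.mul_sum]
  refine mul_le_of_le_one_right hA ((le_abs_self _).trans
    (abs_sum_translates_le (g := unitBump) (fun y => ?_) (fun y hy => ?_) s _))
  · rw [abs_of_nonneg unitBump.nonneg]; exact unitBump.le_one
  · simpa using iteratedDeriv_unitBump_eq_zero 0 hy

theorem continuous_bumpFun (l A : ℝ) {m : ℕ} (s : Finset (Fin m)) : Continuous (bumpFun l A s) := by
  have := continuous_bumpPiece A m
  unfold bumpFun; fun_prop

theorem le_bumpFun (l : ℝ) {A : ℝ} (hA : 0 ≤ A) {m : ℕ} (s : Finset (Fin m)) (x : ℝ) :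
    l ≤ bumpFun l A s x :=
  le_add_of_nonneg_right (Finset.sum_nonneg fun _ _ => bumpPiece_nonneg hA _ _ _)

theorem bumpFun_insert (l A : ℝ) {m : ℕ} {s : Finset (Fin m)} {j : Fin m} (hj : j ∉ s) (x : ℝ) :
    bumpFun l A (insert j s) x = bumpFun l A s x + bumpPiece A m j x := by
  rw [bumpFun, bumpFun, Finset.sum_insert hj]; ring

/-- The `k`-th derivative of `bumpFun`. -/
noncomputable def bumpFunDeriv (l A : ℝ) {m : ℕ} (s : Finset (Fin m)) (k : ℕ) (x : ℝ) : ℝ :=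
  (if k = 0 then l else 0) + A * m ^ k * ∑ j ∈ s, iteratedDeriv k unitBump (m * x - j)

theorem hasDerivAt_bumpFunDeriv (l A : ℝ) {m : ℕ} (s : Finset (Fin m)) (k : ℕ) (x : ℝ) :
    HasDerivAt (bumpFunDeriv l A s k) (bumpFunDeriv l A s (k + 1) x) x := by
  have h1 : ∀ j : Fin m, HasDerivAt (fun x : ℝ => iteratedDeriv k unitBump (m * x - j))
      (iteratedDeriv (k + 1) unitBump (m * x - j) * m) x := by
    intro j
    refine (hasDerivAt_iteratedDeriv_unitBump k _).comp x ?_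
    simpa using ((hasDerivAt_id x).const_mul (m : ℝ)).sub_const (j : ℝ)
  have h2 := ((HasDerivAt.fun_sum fun j (_ : j ∈ s) => h1 j).const_mul (A * m ^ k)).const_add
    (if k = 0 then l else 0)
  refine HasDerivAt.congr_deriv (f := bumpFunDeriv l A s k) h2 ?_
  simp only [bumpFunDeriv, if_neg (Nat.succ_ne_zero k), ← Finset.sum_mul]
  ring

theorem iteratedDerivWithin_bumpFun (l A : ℝ) {m : ℕ} (s : Finset (Fin m)) (k : ℕ) :
    ∀ x ∈ Icc (0 : ℝ) 1, iteratedDerivWithin k (bumpFun l A s) (Icc 0 1) x =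
      bumpFunDeriv l A s k x := by
  induction k with
  | zero =>
    intro x _
    simp [bumpFun, bumpFunDeriv, bumpPiece, Finset.mul_sum]
  | succ k ih =>
    intro x hx
    rw [iteratedDerivWithin_succ, derivWithin_congr ih (ih x hx)]
    exact (hasDerivAt_bumpFunDeriv l A s k x).hasDerivWithinAt.derivWithin
      (uniqueDiffOn_Icc zero_lt_one x hx)

/-- Scaling: p derivatives produce m^p and the Hölder quotient produces m^(α-p), which together
cancel the height m^(-α). The admissible `a₀` is therefore independent of m. -/
theorem exists_bumpFun_mem_holderClass {α L : ℝ} (hα : 0 ≤ α) (hL : 0 < L) :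
    ∃ a₀ : ℝ, 0 < a₀ ∧ ∀ l u a : ℝ, 0 < a → a ≤ a₀ → a ≤ u - l → ∀ m : ℕ, 0 < m →
      ∀ s : Finset (Fin m), bumpFun l (a * (m : ℝ) ^ (-α)) s ∈ holderClass α L l u := by
  set p := ⌊α⌋₊ with hp
  obtain ⟨B, hB0, hB⟩ := exists_bound_iteratedDeriv_unitBump p
  obtain ⟨B', hB0', hB'⟩ := exists_bound_iteratedDeriv_unitBump (p + 1)
  have hβ0 : 0 ≤ α - p := sub_nonneg.2 (Nat.floor_le hα)
  have hβ1 : α - p ≤ 1 := by linarith [Nat.lt_floor_add_one α]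
  refine ⟨L / (2 * B + B'), by positivity, fun l u a ha ha0 hau m hm s => ?_⟩
  have hm0 : (0 : ℝ) < m := by exact_mod_cast hm
  have hm1 : (1 : ℝ) ≤ m := by exact_mod_cast hm
  set A := a * (m : ℝ) ^ (-α) with hA
  have hA0 : 0 < A := by positivity
  have hAa : A ≤ a := mul_le_of_le_one_right ha.le
    (Real.rpow_le_one_of_one_le_of_nonpos hm1 (by linarith))
  refine ⟨fun k _ => ?_, fun x hx y hy => ?_, fun x _ => ⟨le_bumpFun l hA0.le s x, ?_⟩⟩
  · refine DifferentiableOn.congr (fun x _ => ?_) (iteratedDerivWithin_bumpFun l A s k)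
    exact (hasDerivAt_bumpFunDeriv l A s k x).differentiableAt.differentiableWithinAt
  · rw [iteratedDerivWithin_bumpFun l A s _ x hx, iteratedDerivWithin_bumpFun l A s _ y hy,
      bumpFunDeriv, bumpFunDeriv, add_sub_add_left_eq_sub, ← mul_sub, abs_mul, ← hp,
      abs_of_pos (by positivity : 0 < A * (m : ℝ) ^ p)]
    set S : ℝ → ℝ := fun z => ∑ j ∈ s, iteratedDeriv p unitBump (z - j) with hS
    have hS1 : ∀ z, |S z| ≤ B := abs_sum_translates_le hB
      (fun y hy => iteratedDeriv_unitBump_eq_zero p hy) s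
    have hS2 : ∀ z z', |S z - S z'| ≤ B' * |z - z'| := by
      intro z z'
      have hd : ∀ x, HasDerivAt S (∑ j ∈ s, iteratedDeriv (p + 1) unitBump (x - j)) x := by
        intro x
        refine HasDerivAt.fun_sum fun j _ => ?_
        exact (hasDerivAt_iteratedDeriv_unitBump p _).comp_sub_const x _
      exact Convex.norm_image_sub_le_of_norm_hasDerivWithin_le (s := univ)
        (fun x _ => (hd x).hasDerivWithinAt)
        (fun x _ => abs_sum_translates_le hB'
          (fun y hy => iteratedDeriv_unitBump_eq_zero (p + 1) hy) s x) convex_univ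
        (mem_univ _) (mem_univ _)
    -- The Lipschitz bound serves at distances up to 1 and the sup bound beyond; 0 ≤ α - p ≤ 1 makes
    -- both fit the power.
    have hS3 : ∀ z z', |S z - S z'| ≤ (2 * B + B') * |z - z'| ^ (α - p) := by
      intro z z'
      rcases le_total |z - z'| 1 with h | h
      · have h1 : |z - z'| ≤ |z - z'| ^ (α - p) := by
          conv_lhs => rw [← Real.rpow_one |z - z'|]
          exact Real.rpow_le_rpow_of_exponent_ge' (abs_nonneg _) h hβ0 hβ1
        have h2 : 0 ≤ |z - z'| ^ (α - p) := by positivity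
        nlinarith [hS2 z z']
      · have h1 : 1 ≤ |z - z'| ^ (α - p) := Real.one_le_rpow h hβ0
        have h2 : |S z - S z'| ≤ 2 * B := by
          refine (abs_sub _ _).trans ?_
          linarith [hS1 z, hS1 z']
        nlinarith
    have hzz : |(m : ℝ) * x - m * y| = m * |x - y| := by
      rw [← mul_sub, abs_mul, abs_of_pos hm0]
    have hpow : A * (m : ℝ) ^ p * (m : ℝ) ^ (α - p) = a := by
      rw [hA, ← Real.rpow_natCast, mul_assoc, mul_assoc, ← Real.rpow_add hm0, ← Real.rpow_add hm0]
      have : -α + ((p : ℝ) + (α - p)) = 0 := by ring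
      rw [this, Real.rpow_zero, mul_one]
    calc A * (m : ℝ) ^ p * |S (m * x) - S (m * y)|
        ≤ A * (m : ℝ) ^ p * ((2 * B + B') * (m * |x - y|) ^ (α - p)) := by
          gcongr
          rw [← hzz]
          exact hS3 _ _
      _ = (A * (m : ℝ) ^ p * (m : ℝ) ^ (α - p)) * (2 * B + B') * |x - y| ^ (α - p) := by
          rw [Real.mul_rpow hm0.le (abs_nonneg _)]; ring
      _ ≤ L * |x - y| ^ (α - p) := by
          rw [hpow]
          gcongr
          exact (le_div_iff₀ (by positivity)).1 ha0
  · have := sum_bumpPiece_le hA0.le s x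
    rw [bumpFun]; linarith

/-- The bump equals its height on the middle quarter of its cell, an interval of length 1/(4m). -/
theorem le_setLIntegral_bumpPiece_sq {A c : ℝ} {m : ℕ} (hm : 0 < m) (j : ℕ) :
    ENNReal.ofReal (A ^ 2 / (8 * m) * c) ≤
      ∫⁻ t in Ioc ((j : ℝ) / m) (((j : ℝ) + 1) / m),
        ENNReal.ofReal (bumpPiece A m j t ^ 2 / 2 * c) := by
  have hm0 : (0 : ℝ) < m := by exact_mod_cast hm
  have hsub : Ioc (((j : ℝ) + 3 / 8) / m) (((j : ℝ) + 5 / 8) / m) ⊆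
      Ioc ((j : ℝ) / m) (((j : ℝ) + 1) / m) := by
    apply Ioc_subset_Ioc <;> gcongr <;> linarith
  refine le_trans ?_ (lintegral_mono_set hsub)
  have : ∫⁻ t in Ioc (((j : ℝ) + 3 / 8) / m) (((j : ℝ) + 5 / 8) / m),
      ENNReal.ofReal (bumpPiece A m j t ^ 2 / 2 * c) =
      ∫⁻ t in Ioc (((j : ℝ) + 3 / 8) / m) (((j : ℝ) + 5 / 8) / m),
        ENNReal.ofReal (A ^ 2 / 2 * c) := by
    refine setLIntegral_congr_fun measurableSet_Ioc fun t ht => ?_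
    have h1 : unitBump (m * t - j) = 1 := by
      apply unitBump.one_of_mem_closedBall
      have h1 := (div_lt_iff₀ hm0).1 ht.1
      have h2 := (le_div_iff₀ hm0).1 ht.2
      rw [Real.closedBall_eq_Icc]
      simp only [unitBump]
      constructor <;> linarith
    simp only [bumpPiece, h1, mul_one]
  rw [this, setLIntegral_const, Real.volume_Ioc,
    ← ENNReal.ofReal_mul' (by rw [sub_nonneg]; gcongr; norm_num)]
  apply ENNReal.ofReal_le_ofReal
  apply le_of_eq
  field_simp
  ring

/-! ### The n^(1/4) trace bound and Assouad's lemma -/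

/-- The choice M = ⌈n^(1/4)⌉ balances M against n/M³. The 6 comes from 2(M+1) ≤ 2(n^(1/4) + 2) ≤ 6
n^(1/4). -/
theorem trace_inv_obsMat_mul_covMat_le_rpow {v w : ℝ → ℝ} {τ l δ : ℝ} {n : ℕ} (hn : 0 < n)
    (hτ : 0 < τ) (hl : 0 < l) (hδ : 0 ≤ δ)
    (hv : ContinuousOn v (Icc 0 1)) (hvl : ∀ s ∈ Icc (0 : ℝ) 1, l ≤ v s)
    (hw : ContinuousOn w (Icc 0 1)) (hwδ : ∀ s ∈ Icc (0 : ℝ) 1, w s ≤ δ) :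
    Matrix.trace ((obsMat τ n v)⁻¹ * covMat n w) ≤
      δ * ((6 / l + 1 / τ ^ 2) * (n : ℝ) ^ (1 / 4 : ℝ)) := by
  have hn1 : (1 : ℝ) ≤ n := by exact_mod_cast hn
  set q : ℝ := (n : ℝ) ^ (1 / 4 : ℝ) with hq
  have hq1 : 1 ≤ q := Real.one_le_rpow hn1 (by norm_num)
  have hq4 : q ^ 4 = n := by
    rw [hq, ← Real.rpow_natCast, ← Real.rpow_mul (by positivity)]; norm_num
  have hM : 0 < ⌈q⌉₊ := Nat.ceil_pos.2 (by linarith)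
  have h1 : (⌈q⌉₊ : ℝ) ≤ q + 1 := (Nat.ceil_lt_add_one (by linarith)).le
  have h2 : q ≤ ⌈q⌉₊ := Nat.le_ceil q
  refine (trace_inv_obsMat_mul_covMat_le hτ hl hδ hv hvl hw hwδ hM).trans ?_
  refine mul_le_mul_of_nonneg_left ?_ hδ
  rw [add_mul]
  refine add_le_add ?_ ?_
  · rw [div_mul_eq_mul_div]
    exact div_le_div_of_nonneg_right (by linarith) hl.le
  · calc (n : ℝ) / (τ ^ 2 * (⌈q⌉₊ : ℝ) ^ 3) ≤ n / (τ ^ 2 * q ^ 3) := by gcongr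
      _ = _ := by rw [← hq4]; field_simp

theorem trace_inv_obsMat_mul_covMat_nonneg {v w : ℝ → ℝ} {τ : ℝ} {n : ℕ} (hτ : 0 < τ)
    (hv : ContinuousOn v (Icc 0 1)) (hv0 : ∀ s ∈ Icc (0 : ℝ) 1, 0 ≤ v s)
    (hw : ContinuousOn w (Icc 0 1)) (hw0 : ∀ s ∈ Icc (0 : ℝ) 1, 0 ≤ w s) :
    0 ≤ Matrix.trace ((obsMat τ n v)⁻¹ * covMat n w) := by
  obtain ⟨T, d, -, hTK, hTT, hd⟩ := exists_simultaneous_diagonalization _ _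
    (obsMat_posDef (n := n) hτ hv hv0) (covMat_posSemidef (n := n) hw hw0)
  rw [← hTT, Matrix.mul_assoc, Matrix.trace_mul_comm, hTK, Matrix.trace_diagonal]
  exact Finset.sum_nonneg fun i _ => hd i

theorem sum_finset_eq_sum_pairs {M : Type*} [AddCommMonoid M] {m : ℕ} (F : Finset (Fin m) → M)
    (j : Fin m) : ∑ s, F s = ∑ s with j ∉ s, (F s + F (insert j s)) := by
  rw [← Finset.sum_filter_add_sum_filter_not Finset.univ (fun s : Finset (Fin m) => j ∉ s),
    Finset.sum_add_distrib]
  congr 1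
  refine (Finset.sum_nbij' (fun s => insert j s) (fun s => s.erase j) ?_ ?_ ?_ ?_ ?_).symm
  · simp
  · simp
  · intro s hs
    exact Finset.erase_insert (by simpa using hs)
  · intro s hs
    exact Finset.insert_erase (by simpa using hs)
  · simp

theorem ofReal_sum_le_sum_ofReal {ι : Type*} (s : Finset ι) (f : ι → ℝ) :
    ENNReal.ofReal (∑ i ∈ s, f i) ≤ ∑ i ∈ s, ENNReal.ofReal (f i) := by
  classical
  induction s using Finset.induction_on with
  | empty => simp
  | insert i s hi ih =>
    rw [Finset.sum_insert hi, Finset.sum_insert hi]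
    exact ENNReal.ofReal_add_le.trans (by gcongr)

/-- Assouad's lemma. -/
theorem assouad {m : ℕ} (ρ : Finset (Fin m) → Fin m → ℝ≥0∞) (q : Finset (Fin m) → Fin m → ℝ)
    (R : ℝ≥0∞) (b : ℝ) (hb : 0 ≤ b) (hR : ∀ s, ∑ j, ρ s j ≤ R)
    (hpair : ∀ s j, j ∉ s → ENNReal.ofReal (b * (1 - q s j)) ≤ ρ s j + ρ (insert j s) j)
    (hq0 : ∀ s j, 0 ≤ q s j) (hq : ∀ s, ∑ j, q s j ≤ m / 4) :
    ENNReal.ofReal (b * m / 4) ≤ R := by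
  have hcard : ∀ j : Fin m, (2 : ℝ) ^ m = 2 * ((Finset.univ.filter
      fun s : Finset (Fin m) => j ∉ s).card : ℝ) := by
    intro j
    have h := sum_finset_eq_sum_pairs (fun _ : Finset (Fin m) => (1 : ℝ)) j
    simp only [Finset.sum_const, nsmul_eq_mul, mul_one, Finset.card_univ, Fintype.card_finset,
      Fintype.card_fin] at h
    push_cast at h
    rw [h]; ring
  -- Half of the vertices omit j, which contributes m 2^m / 2 in total. The q-terms, enlarged to all
  -- vertices, remove at most 2^m m / 4. Only the sum of q over j has to be small, not each q.
  have hreal : (2 : ℝ) ^ m * (b * m / 4) ≤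
      ∑ j : Fin m, ∑ s : Finset (Fin m) with j ∉ s, b * (1 - q s j) := by
    have h1 : ∀ j : Fin m, ∑ s : Finset (Fin m) with j ∉ s, b * (1 - q s j) ≥
        b * (2 ^ m / 2 - ∑ s, q s j) := by
      intro j
      rw [← Finset.mul_sum, Finset.sum_sub_distrib]
      refine mul_le_mul_of_nonneg_left ?_ hb
      have h2 : ∑ s : Finset (Fin m) with j ∉ s, q s j ≤ ∑ s, q s j :=
        Finset.sum_le_sum_of_subset_of_nonneg (Finset.filter_subset _ _) fun _ _ _ => hq0 _ _
      rw [Finset.sum_const, nsmul_eq_mul, mul_one]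
      have := hcard j
      linarith
    refine le_trans ?_ (Finset.sum_le_sum fun j _ => h1 j)
    rw [← Finset.mul_sum, Finset.sum_sub_distrib, Finset.sum_comm]
    have h3 : ∑ s : Finset (Fin m), ∑ j, q s j ≤ 2 ^ m * (m / 4) := by
      refine (Finset.sum_le_sum fun s _ => hq s).trans_eq ?_
      simp [Finset.card_univ]
    simp only [Finset.sum_const, Finset.card_univ, Fintype.card_fin, nsmul_eq_mul]
    nlinarith
  have h2 : ENNReal.ofReal ((2 : ℝ) ^ m * (b * m / 4)) ≤ 2 ^ m * R := by
    calc _ ≤ ENNReal.ofReal (∑ j : Fin m, ∑ s : Finset (Fin m) with j ∉ s, b * (1 - q s j)) :=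
          ENNReal.ofReal_le_ofReal hreal
      _ ≤ ∑ j : Fin m, ∑ s : Finset (Fin m) with j ∉ s, ENNReal.ofReal (b * (1 - q s j)) :=
          (ofReal_sum_le_sum_ofReal _ _).trans
            (Finset.sum_le_sum fun j _ => ofReal_sum_le_sum_ofReal _ _)
      _ ≤ ∑ j : Fin m, ∑ s : Finset (Fin m) with j ∉ s, (ρ s j + ρ (insert j s) j) :=
          Finset.sum_le_sum fun j _ => Finset.sum_le_sum fun s hs =>
            hpair s j (by simpa using hs)
      _ = ∑ s, ∑ j, ρ s j := by
          rw [Finset.sum_comm]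
          exact Finset.sum_congr rfl fun j _ =>
            (sum_finset_eq_sum_pairs (fun s => ρ s j) j).symm
      _ ≤ ∑ _s : Finset (Fin m), R := Finset.sum_le_sum fun s _ => hR s
      _ = 2 ^ m * R := by simp [Finset.card_univ]
  rw [ENNReal.ofReal_mul (by positivity), ENNReal.ofReal_pow (by norm_num)] at h2
  simp only [ENNReal.ofReal_ofNat] at h2
  exact (ENNReal.mul_le_mul_iff_right (by simp) (by simp)).1 h2

theorem sum_setLIntegral_grid_le {m : ℕ} (hm : 0 < m) (f : ℝ → ℝ≥0∞) :
    ∑ j : Fin m, ∫⁻ t in Ioc ((j : ℝ) / m) (((j : ℝ) + 1) / m), f t ≤ ∫⁻ t in Icc (0 : ℝ) 1, f t := by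
  have hm0 : (0 : ℝ) < m := by exact_mod_cast hm
  rw [← tsum_fintype (L := SummationFilter.unconditional _), ← lintegral_iUnion]
  · refine lintegral_mono_set (iUnion_subset fun j x hx => ?_)
    have hj : ((j : ℕ) : ℝ) + 1 ≤ m := by exact_mod_cast j.2
    exact ⟨le_trans (by positivity) hx.1.le, hx.2.trans ((div_le_one hm0).2 hj)⟩
  · exact fun _ => measurableSet_Ioc
  · intro i j hij
    refine disjoint_left.2 fun x hi hj => hij (Fin.ext ?_)
    have h1 := (div_lt_iff₀ hm0).1 hi.1
    have h2 := (le_div_iff₀ hm0).1 hi.2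
    have h3 := (div_lt_iff₀ hm0).1 hj.1
    have h4 := (le_div_iff₀ hm0).1 hj.2
    have h5 : ((i : ℕ) : ℝ) < (j : ℕ) + 1 := by linarith
    have h6 : ((j : ℕ) : ℝ) < (i : ℕ) + 1 := by linarith
    have h5' : (i : ℕ) < j + 1 := by exact_mod_cast h5
    have h6' : (j : ℕ) < i + 1 := by exact_mod_cast h6
    omega

/-! ### Minimax lower bounds -/

section Minimax

variable {Ω : Type*} [MeasurableSpace Ω] {P : Measure Ω} [IsProbabilityMeasure P]
  {W : ℝ≥0 → Ω → ℝ} {ε : (n : ℕ) → Fin n → Ω → ℝ} {X : (ℝ → ℝ) → ℝ≥0 → Ω → ℝ} {τ : ℝ} {n : ℕ}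

/-- At each fixed t the estimate is a real estimator of the value at t, so the two-point bound holds
pointwise. Integrating over the j-th cell gives the pair condition of `assouad`. -/
theorem ofReal_le_minimaxRiskFun (hτ : 0 < τ) (hn : 0 < n) (hM : IsNoisyVolatilityModel P W ε X)
    {V : Set (ℝ → ℝ)} {l A r : ℝ} {m : ℕ} (hl : 0 < l) (hA : 0 ≤ A) (hr : 0 ≤ r) (hm : 0 < m)
    (hV : ∀ s : Finset (Fin m), bumpFun l A s ∈ V)
    (hAm : A ^ 2 / (8 * l) * ((6 / l + 1 / τ ^ 2) * (n : ℝ) ^ (1 / 4 : ℝ)) ≤ m / 4) :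
    ENNReal.ofReal (r * (A ^ 2 / 32)) ≤ minimaxRiskFun P τ n (ε n) X V r := by
  refine le_iInf₂ fun est hest => ?_
  set R := ⨆ v ∈ V, ∫⁻ ω, ENNReal.ofReal r *
    sqL2Dist (est (integratedObservation τ n (X fun s => √(v s)) (ε n) ω)) v ∂P with hRdef
  have hvc : ∀ s : Finset (Fin m), ContinuousOn (bumpFun l A s) (Icc 0 1) := fun s =>
    (continuous_bumpFun l A s).continuousOn
  have hvl : ∀ s : Finset (Fin m), ∀ t ∈ Icc (0 : ℝ) 1, l ≤ bumpFun l A s t := fun s t _ =>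
    le_bumpFun l hA s t
  have hv0 : ∀ s : Finset (Fin m), ∀ t ∈ Icc (0 : ℝ) 1, 0 < bumpFun l A s t := fun s t ht =>
    hl.trans_le (hvl s t ht)
  set Y : Finset (Fin m) → Ω → Fin n → ℝ := fun s =>
    integratedObservation τ n (X fun t => √(bumpFun l A s t)) (ε n) with hY
  have hYm : ∀ s, AEMeasurable (Y s) P := fun s => aemeasurable_observation hM (hvc s) (hv0 s)
  have hint : ∀ s : Finset (Fin m), Measurable fun p : (Fin n → ℝ) × ℝ =>
      ENNReal.ofReal ((est p.1 p.2 - bumpFun l A s p.2) ^ 2) := fun s =>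
    ((hest.sub ((continuous_bumpFun l A s).measurable.comp measurable_snd)).pow_const 2).ennreal_ofReal
  set f : Finset (Fin m) → ℝ → ℝ≥0∞ := fun s t =>
    ∫⁻ ω, ENNReal.ofReal ((est (Y s ω) t - bumpFun l A s t) ^ 2) ∂P with hf
  -- `Y s` is only almost everywhere measurable, so Tonelli is applied under its law, where the
  -- estimator is jointly measurable.
  have hfeq : ∀ s t, f s t =
      ∫⁻ y, ENNReal.ofReal ((est y t - bumpFun l A s t) ^ 2) ∂(P.map (Y s)) := fun s t =>
    (lintegral_map' ((hint s).comp (measurable_id.prodMk measurable_const)).aemeasurable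
      (hYm s)).symm
  have hprob : ∀ s, IsProbabilityMeasure (P.map (Y s)) := fun s =>
    Measure.isProbabilityMeasure_map (hYm s)
  have hfm : ∀ s, Measurable (f s) := by
    intro s
    have : f s = fun t => ∫⁻ y, ENNReal.ofReal ((est y t - bumpFun l A s t) ^ 2)
      ∂(P.map (Y s)) := funext (hfeq s)
    rw [this]
    exact Measurable.lintegral_prod_left' (hint s)
  have hrisk : ∀ s, ENNReal.ofReal r * ∫⁻ t in Icc (0 : ℝ) 1, f s t ≤ R := by
    intro s
    have h1 : ∫⁻ ω, sqL2Dist (est (Y s ω)) (bumpFun l A s) ∂P =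
        ∫⁻ t in Icc (0 : ℝ) 1, f s t := by
      have h2 : Measurable fun y => sqL2Dist (est y) (bumpFun l A s) :=
        Measurable.lintegral_prod_right' (hint s)
      rw [← lintegral_map' h2.aemeasurable (hYm s)]
      simp_rw [hfeq]
      exact lintegral_lintegral_swap (hint s).aemeasurable
    rw [← h1, ← lintegral_const_mul' _ _ ENNReal.ofReal_ne_top]
    exact le_iSup₂ (f := fun v _ => ∫⁻ ω, ENNReal.ofReal r *
      sqL2Dist (est (integratedObservation τ n (X fun s => √(v s)) (ε n) ω)) v ∂P) _ (hV s)
  have hm0 : (0 : ℝ) < m := by exact_mod_cast hm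
  set q : Finset (Fin m) → Fin m → ℝ := fun s j => A / l / 8 *
    Matrix.trace ((obsMat τ n (bumpFun l A s))⁻¹ * covMat n (bumpPiece A m j)) with hq
  have hpc : ∀ j : Fin m, ContinuousOn (bumpPiece A m j) (Icc 0 1) := fun j =>
    (continuous_bumpPiece A m j).continuousOn
  have key := assouad (fun s j => ENNReal.ofReal r *
      ∫⁻ t in Ioc ((j : ℝ) / m) (((j : ℝ) + 1) / m), f s t) q R
    (r * (A ^ 2 / (8 * m))) (by positivity) (fun s => ?_) (fun s j hj => ?_) (fun s j => ?_)
    (fun s => ?_)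
  · have e : r * (A ^ 2 / (8 * m)) * m / 4 = r * (A ^ 2 / 32) := by field_simp; ring
    rwa [e] at key
  · rw [← Finset.mul_sum]
    exact (mul_le_mul_right (sum_setLIntegral_grid_le hm (f s)) _).trans (hrisk s)
  · rw [← mul_add, ← lintegral_add_left (hfm s), mul_assoc, ENNReal.ofReal_mul hr]
    refine mul_le_mul_right ((le_setLIntegral_bumpPiece_sq hm j).trans
      (lintegral_mono fun t => ?_)) _
    have htp := two_point_observation (n := n) hτ hM (hvc s) (hv0 s) (hpc j)
      (fun t _ => bumpPiece_nonneg hA m j t) (κ := A / l) (by positivity) (fun t ht => by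
        refine (bumpPiece_le hA m j t).trans ?_
        calc A = A / l * l := by field_simp
          _ ≤ A / l * bumpFun l A s t := by gcongr; exact hvl s t ht)
      (fun y => est y t) (hest.comp (measurable_id.prodMk measurable_const))
      (bumpFun l A s t) (bumpFun l A (insert j s) t)
    have hins : (fun t => bumpFun l A s t + bumpPiece A m j t) = bumpFun l A (insert j s) :=
      funext fun t => (bumpFun_insert l A hj t).symm
    have hsq : (bumpFun l A s t - bumpFun l A (insert j s) t) ^ 2 = bumpPiece A m j t ^ 2 := by
      rw [bumpFun_insert l A hj]; ring
    have hX1 : (fun t => √(bumpFun l A s t + bumpPiece A m j t)) =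
        fun t => √(bumpFun l A (insert j s) t) := by
      ext t; rw [bumpFun_insert l A hj]
    rw [hsq, hX1] at htp
    exact htp
  · exact mul_nonneg (by positivity) (trace_inv_obsMat_mul_covMat_nonneg hτ (hvc s)
      (fun t ht => (hv0 s t ht).le) (hpc j) fun t _ => bumpPiece_nonneg hA m j t)
  -- Linearity of the trace replaces m separate bounds by one for the sum of all bumps, whose
  -- supremum is still at most A. This gains a factor m.
  · have h1 : ∑ j, q s j = A / l / 8 * Matrix.trace ((obsMat τ n (bumpFun l A s))⁻¹ *
        covMat n (fun t => ∑ j : Fin m, bumpPiece A m j t)) := by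
      rw [covMat_sum _ fun j _ => hpc j, Matrix.mul_sum, Matrix.trace_sum, Finset.mul_sum]
    have h2 := trace_inv_obsMat_mul_covMat_le_rpow hn hτ hl hA (hvc s) (hvl s)
      (continuousOn_finsetSum _ fun j _ => hpc j)
      (fun t _ => sum_bumpPiece_le hA (Finset.univ : Finset (Fin m)) t)
    rw [h1]
    refine le_trans ?_ hAm
    refine (mul_le_mul_of_nonneg_left h2 (by positivity)).trans_eq ?_
    field_simp

theorem ofReal_le_minimaxRiskConst (hτ : 0 < τ) (hn : 0 < n) (hM : IsNoisyVolatilityModel P W ε X)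
    {V : Set ℝ} {l h r : ℝ} (hl : 0 < l) (hh : 0 ≤ h) (hr : 0 ≤ r) (hlV : l ∈ V) (hhV : l + h ∈ V)
    (hhn : h ^ 2 / (8 * l) * ((6 / l + 1 / τ ^ 2) * (n : ℝ) ^ (1 / 4 : ℝ)) ≤ 1 / 2) :
    ENNReal.ofReal (r * (h ^ 2 / 8)) ≤ minimaxRiskConst P τ n (ε n) X V r := by
  refine le_iInf₂ fun est hest => ?_
  set R := ⨆ v ∈ V, ∫⁻ ω, ENNReal.ofReal
    (r * (est (integratedObservation τ n (X fun _ => √v) (ε n) ω) - v) ^ 2) ∂P with hRdef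
  have hrisk : ∀ v ∈ V, ENNReal.ofReal r * ∫⁻ ω, ENNReal.ofReal
      ((est (integratedObservation τ n (X fun _ => √v) (ε n) ω) - v) ^ 2) ∂P ≤ R := by
    intro v hv
    rw [← lintegral_const_mul' _ _ ENNReal.ofReal_ne_top]
    simp_rw [← ENNReal.ofReal_mul hr]
    exact le_iSup₂ (f := fun v _ => ∫⁻ ω, ENNReal.ofReal
      (r * (est (integratedObservation τ n (X fun _ => √v) (ε n) ω) - v) ^ 2) ∂P) v hv
  have htp := two_point_observation (n := n) hτ hM (v := fun _ => l) (h := fun _ => h)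
    continuousOn_const (fun _ _ => hl) continuousOn_const (fun _ _ => hh) (κ := h / l)
    (by positivity) (fun _ _ => by field_simp; exact le_rfl) est hest l (l + h)
  have htr := trace_inv_obsMat_mul_covMat_le_rpow hn hτ hl hh (v := fun _ => l) (w := fun _ => h)
    continuousOn_const (fun _ _ => le_rfl) continuousOn_const (fun _ _ => le_rfl)
  have h1 : h / l / 8 * Matrix.trace ((obsMat τ n fun _ => l)⁻¹ * covMat n fun _ => h) ≤ 1 / 2 := by
    refine le_trans ?_ hhn
    refine (mul_le_mul_of_nonneg_left htr (by positivity)).trans_eq ?_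
    field_simp
  have h2 : ENNReal.ofReal (r * (h ^ 2 / 4)) ≤ R + R := by
    refine le_trans ?_ (add_le_add (hrisk l hlV) (hrisk (l + h) hhV))
    rw [← mul_add, ENNReal.ofReal_mul hr]
    refine mul_le_mul_right (le_trans (ENNReal.ofReal_le_ofReal ?_) htp) _
    have : (l - (l + h)) ^ 2 = h ^ 2 := by ring
    rw [this]
    nlinarith [sq_nonneg h]
  have h3 : r * (h ^ 2 / 4) = 2 * (r * (h ^ 2 / 8)) := by ring
  rw [h3, ENNReal.ofReal_mul (by norm_num), ← two_mul, ENNReal.ofReal_ofNat] at h2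
  exact (ENNReal.mul_le_mul_iff_right (by simp) (by simp)).1 h2

end Minimax

/-- The bump height constant or the spacing constant: small enough for the parameter set and for the
information budget. -/
theorem exists_height {c C l : ℝ} (hc : 0 < c) (hC : 0 < C) (hl : 0 < l) :
    ∃ a, 0 < a ∧ a ≤ c ∧ a ^ 2 / (8 * l) * C ≤ 1 / 4 := by
  refine ⟨min c (min 1 (2 * l / C)), by positivity, min_le_left _ _, ?_⟩
  set a := min c (min 1 (2 * l / C))
  have h0 : 0 ≤ a := by positivity
  have h1 : a ≤ 1 := (min_le_right _ _).trans (min_le_left _ _)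
  have h2 : a ≤ 2 * l / C := (min_le_right _ _).trans (min_le_right _ _)
  have h3 : a * C ≤ 2 * l := (le_div_iff₀ hC).1 h2
  rw [div_mul_eq_mul_div, div_le_iff₀ (by positivity)]
  nlinarith

theorem mainTheorem3 (τ : ℝ) (hτ : 0 < τ) :
    (∀ α L l u : ℝ, 1 / 2 < α → 0 < L → 0 < l → l < u →
      ∃ C : ℝ, 0 < C ∧
        ∀ (Ω : Type*) [MeasurableSpace Ω] (P : Measure Ω) [IsProbabilityMeasure P]
          (W : ℝ≥0 → Ω → ℝ) (ε : (n : ℕ) → Fin n → Ω → ℝ) (X : (ℝ → ℝ) → ℝ≥0 → Ω → ℝ),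
          IsNoisyVolatilityModel P W ε X →
          ENNReal.ofReal C ≤ liminf (fun n : ℕ =>
            minimaxRiskFun P τ n (ε n) X (holderClass α L l u)
              ((n : ℝ) ^ (α / (4 * α + 2)))) atTop) ∧
    (∀ σmin σmax : ℝ, 0 < σmin → σmin < σmax →
      ∃ C : ℝ, 0 < C ∧
        ∀ (Ω : Type*) [MeasurableSpace Ω] (P : Measure Ω) [IsProbabilityMeasure P]
          (W : ℝ≥0 → Ω → ℝ) (ε : (n : ℕ) → Fin n → Ω → ℝ) (X : (ℝ → ℝ) → ℝ≥0 → Ω → ℝ),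
          IsNoisyVolatilityModel P W ε X →
          ENNReal.ofReal C ≤ liminf (fun n : ℕ =>
            minimaxRiskConst P τ n (ε n) X (Icc σmin σmax)
              ((n : ℝ) ^ (1 / 4 : ℝ))) atTop) := by
  refine ⟨fun α L l u hα hL hl hlu => ?_, fun σmin σmax hmin hmax => ?_⟩
  · obtain ⟨a₀, ha₀, hmem⟩ := exists_bumpFun_mem_holderClass (α := α) (by linarith) hL
    obtain ⟨a, ha, hac, haC⟩ := exists_height (c := min a₀ (u - l)) (C := 6 / l + 1 / τ ^ 2)
      (lt_min ha₀ (sub_pos.2 hlu)) (by positivity) hl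
    refine ⟨a ^ 2 * 2 ^ (-(2 * α)) / 32, by positivity, fun Ω _ P _ W ε X hM => ?_⟩
    refine le_liminf_of_le (h := ?_)
    filter_upwards [eventually_gt_atTop 0] with n hn
    have hn0 : (0 : ℝ) < n := by exact_mod_cast hn
    have hn1 : (1 : ℝ) ≤ n := by exact_mod_cast hn
    -- This exponent solves x^(2α+1) = n^(1/4). Rounding up keeps the information budget, and m ≤ 2x
    -- costs only the factor 2^(-2α) in the constant.
    set x : ℝ := (n : ℝ) ^ (1 / (8 * α + 4)) with hx
    have hx1 : 1 ≤ x := Real.one_le_rpow hn1 (by positivity)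
    set m := ⌈x⌉₊ with hm
    have hm0 : 0 < m := Nat.ceil_pos.2 (by linarith)
    have hm0' : (0 : ℝ) < m := by exact_mod_cast hm0
    have hxm : x ≤ m := Nat.le_ceil x
    have hmx : (m : ℝ) ≤ 2 * x := by
      have := (Nat.ceil_lt_add_one (a := x) (by linarith)).le
      linarith
    have hA2 : (a * (m : ℝ) ^ (-α)) ^ 2 = a ^ 2 * (m : ℝ) ^ (-(2 * α)) := by
      rw [mul_pow, ← Real.rpow_natCast ((m : ℝ) ^ (-α)), ← Real.rpow_mul hm0'.le]
      congr 2; push_cast; ring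
    have hq : (n : ℝ) ^ (1 / 4 : ℝ) ≤ (m : ℝ) ^ (2 * α) * m := by
      have h1 : (n : ℝ) ^ (1 / 4 : ℝ) = x ^ (2 * α + 1) := by
        rw [hx, ← Real.rpow_mul hn0.le]
        congr 1; field_simp; ring
      rw [h1, ← Real.rpow_add_one hm0'.ne']
      exact Real.rpow_le_rpow (by positivity) hxm (by linarith)
    have hmm : (m : ℝ) ^ (-(2 * α)) * (m : ℝ) ^ (2 * α) = 1 := by
      rw [← Real.rpow_add hm0']; simp
    have hAm : (a * (m : ℝ) ^ (-α)) ^ 2 / (8 * l) *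
        ((6 / l + 1 / τ ^ 2) * (n : ℝ) ^ (1 / 4 : ℝ)) ≤ m / 4 := by
      rw [hA2]
      calc _ ≤ a ^ 2 * (m : ℝ) ^ (-(2 * α)) / (8 * l) *
            ((6 / l + 1 / τ ^ 2) * ((m : ℝ) ^ (2 * α) * m)) := by gcongr
        _ = (a ^ 2 / (8 * l) * (6 / l + 1 / τ ^ 2)) *
            ((m : ℝ) ^ (-(2 * α)) * (m : ℝ) ^ (2 * α)) * m := by ring
        _ ≤ m / 4 := by rw [hmm]; nlinarith
    refine le_trans (ENNReal.ofReal_le_ofReal ?_) (ofReal_le_minimaxRiskFun hτ hn hM hl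
      (by positivity) (by positivity) hm0
      (hmem l u a ha (hac.trans (min_le_left _ _)) (hac.trans (min_le_right _ _)) m hm0) hAm)
    have h2 : (2 : ℝ) ^ (-(2 * α)) ≤ (n : ℝ) ^ (α / (4 * α + 2)) * (m : ℝ) ^ (-(2 * α)) := by
      have h3 : (2 * x) ^ (-(2 * α)) ≤ (m : ℝ) ^ (-(2 * α)) :=
        Real.rpow_le_rpow_of_nonpos hm0' hmx (by linarith)
      have h4 : (n : ℝ) ^ (α / (4 * α + 2)) * x ^ (-(2 * α)) = 1 := by
        rw [hx, ← Real.rpow_mul hn0.le, ← Real.rpow_add hn0]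
        have : α / (4 * α + 2) + 1 / (8 * α + 4) * -(2 * α) = 0 := by
          have : (8 * α + 4) = 2 * (4 * α + 2) := by ring
          have h0 : 4 * α + 2 ≠ 0 := by positivity
          rw [this]; field_simp; ring
        rw [this, Real.rpow_zero]
      calc (2 : ℝ) ^ (-(2 * α)) = (n : ℝ) ^ (α / (4 * α + 2)) * (2 * x) ^ (-(2 * α)) := by
            rw [Real.mul_rpow (by norm_num) (by linarith), mul_left_comm, h4, mul_one]
        _ ≤ _ := by gcongr
    rw [hA2]
    nlinarith [mul_le_mul_of_nonneg_left h2 (sq_nonneg a)]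
  · obtain ⟨a, ha, hac, haC⟩ := exists_height (c := σmax - σmin) (C := 6 / σmin + 1 / τ ^ 2)
      (sub_pos.2 hmax) (by positivity) hmin
    refine ⟨a ^ 2 / 8, by positivity, fun Ω _ P _ W ε X hM => ?_⟩
    refine le_liminf_of_le (h := ?_)
    filter_upwards [eventually_gt_atTop 0] with n hn
    have hn0 : (0 : ℝ) < n := by exact_mod_cast hn
    have hn1 : (1 : ℝ) ≤ n := by exact_mod_cast hn
    -- The spacing at which n^(1/4) h² = a² stays constant.
    set h : ℝ := a * (n : ℝ) ^ (-(1 / 8) : ℝ) with hh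
    have h0 : 0 ≤ h := by positivity
    have hle : h ≤ a := mul_le_of_le_one_right ha.le
      (Real.rpow_le_one_of_one_le_of_nonpos hn1 (by norm_num))
    have hsq : (n : ℝ) ^ (1 / 4 : ℝ) * h ^ 2 = a ^ 2 := by
      rw [hh, mul_pow, ← Real.rpow_natCast ((n : ℝ) ^ (-(1 / 8) : ℝ)), ← Real.rpow_mul hn0.le,
        mul_left_comm, ← Real.rpow_add hn0]
      norm_num
    refine le_trans (ENNReal.ofReal_le_ofReal ?_) (ofReal_le_minimaxRiskConst hτ hn hM hmin h0
      (by positivity) ⟨le_rfl, hmax.le⟩ ⟨by linarith, by linarith⟩ ?_)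
    · rw [← mul_div_assoc, hsq]
    · calc _ = ((n : ℝ) ^ (1 / 4 : ℝ) * h ^ 2) / (8 * σmin) * (6 / σmin + 1 / τ ^ 2) := by ring
        _ ≤ 1 / 2 := by rw [hsq]; linarith
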